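/- All vector spaces, Lie algebras and manifolds are complex, and diffeomorphisms and embeddings are holomorphic. Let $\mathfrak{so}(n)=\mathfrak{so}(n,\mathbb{C})$ act on $\mathbb{C}^n$, endowed with the nondegenerate symmetric bilinear form $\langle x,y\rangle=\sum_j x_jy_j$. Let ${\rm Gr}_k^0(n)$ be the complex manifold of $k$-dimensional isotropic subspaces of $\mathbb{C}^n$, and let $Q^d={\rm Gr}_1^0(d+2)$ be the nondegenerate hyperquadric $\{[x]\mid\langle x,x\rangle=0\}$ in the projectivisation of $\mathbb{C}^{d+2}$. Let $\mathfrak{g}_2\subseteq\mathfrak{so}(7)$ be the Lie algebra of infinitesimal automorphisms of the Cayley cross product on $\mathbb{C}^7$ (the complexified imaginary octonions), and let $\rho:\mathfrak{so}(7)\to\mathfrak{so}(8)$ be the $8$-dimensional (irreducible) spin representation of $\mathfrak{so}(7)$. A map between such manifolds, on which a Lie algebra $\mathfrak{g}$ acts through morphisms into orthogonal Lie algebras, is called $\mathfrak{g}$-equivariant (or $\mathfrak{g}$-invariant) if, for each $\xi\in\mathfrak{g}$, it intertwines the flows of the vector fields induced by $\xi$; for a holomorphic map this means that the vector fields induced by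 $\xi$ on the two manifolds are related by the map. (i) There exists an $\mathfrak{so}(7)$-equivariant diffeomorphism from ${\rm Gr}_3^0(7)$ onto $Q^6$, where $\mathfrak{so}(7)$ acts on ${\rm Gr}_3^0(7)$ through its canonical representation on $\mathbb{C}^7$, and on $Q^6$, the hyperquadric in the projectivisation of the spin representation space $\mathbb{C}^8$, through $\rho$. (ii) There exists a $\mathfrak{g}_2$-equivariant embedding of $Q^5$ into ${\rm Gr}_3^0(7)$, where $\mathfrak{g}_2$ acts on both through $\mathfrak{g}_2\subseteq\mathfrak{so}(7)$ and the canonical representation of $\mathfrak{so}(7)$ on $\mathbb{C}^7$. (iii) There exists an embedding of $Q^5$ into ${\rm Gr}_4^0(8)$ which is equivariant with respect to the inclusion $\mathfrak{g}_2\subseteq\mathfrak{so}(7)$, where $\mathfrak{g}_2$ acts on $Q^5$ as in (ii), and $\mathfrak{so}(7)$ acts on ${\rm Gr}_4^0(8)$ through $\rho$. -/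

import Mathlib

open scoped Matrix Manifold ContDiff

attribute [local instance] LieRing.ofAssociativeRing

namespace ExcHol

noncomputable section

/-! ### Isotropic Grassmannians of complex Euclidean space -/

/-- `Gr_k^0(n)`: the set of `k`-dimensional subspaces of `ℂⁿ` that are isotropic for the
nondegenerate complex bilinear form `x ⬝ᵥ y = ∑ i, x i * y i`. For `k = 1` its points are the
isotropic lines, so that `IsoGr 1 n` is the nondegenerate hyperquadric
`{[x] | x ⬝ᵥ x = 0}` of dimension `n - 2` in the projective space of `ℂⁿ`. -/
def IsoGr (k n : ℕ) : Type :=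
  {p : Submodule ℂ (Fin n → ℂ) // Module.finrank ℂ p = k ∧ ∀ x ∈ p, ∀ y ∈ p, x ⬝ᵥ y = 0}

/-- The hyperquadric `Q^d` in the projectivisation of `ℂ^(d+2)`. -/
abbrev Quadric (d : ℕ) : Type := IsoGr 1 (d + 2)

/-- Skew-symmetric `k × k` arrays. -/
def skewArrays (k : ℕ) : Submodule ℂ (Fin k → Fin k → ℂ) where
  carrier := {c | ∀ i j, c i j = -c j i}
  add_mem' := by
    intro a b ha hb i j
    simp only [Pi.add_apply, ha i j, hb i j]; ring
  zero_mem' := by intro i j; simp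
  smul_mem' := by
    intro t a ha i j
    simp only [Pi.smul_apply, smul_eq_mul, ha i j]; ring

/-- The model vector space of the complex manifold `Gr_k^0(n)`, of dimension
`k (n - 2 k) + k (k - 1) / 2`. -/
abbrev GrModel (k n : ℕ) : Type := (Fin (n - 2 * k) → Fin k → ℂ) × skewArrays k

/-- A basis of `ℂⁿ` adapted to a decomposition `ℂⁿ = P ⊕ U ⊕ P'`, with `P` and `P'` isotropic of
dimension `k`, in duality, and orthogonal to `U`; the columns of `A`, `B` and `U` are the bases of
`P`, `P'` and `U`. -/
structure HypFrame (k n : ℕ) where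
  A : Matrix (Fin n) (Fin k) ℂ
  B : Matrix (Fin n) (Fin k) ℂ
  U : Matrix (Fin n) (Fin (n - 2 * k)) ℂ
  AA : Aᵀ * A = 0
  BB : Bᵀ * B = 0
  BA : Bᵀ * A = 1
  UU : Uᵀ * U = 1
  UA : Uᵀ * A = 0
  UB : Uᵀ * B = 0
  complete : A * Bᵀ + B * Aᵀ + U * Uᵀ = 1

/-- The space spanned by the columns of a matrix. -/
def colSpan {k n : ℕ} (X : Matrix (Fin n) (Fin k) ℂ) : Submodule ℂ (Fin n → ℂ) :=
  LinearMap.range X.mulVecLin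

/-- The antisymmetrisation of an array. -/
def skewPart (k : ℕ) : (Fin k → Fin k → ℂ) →ₗ[ℂ] skewArrays k where
  toFun d := ⟨fun i j => (1 / 2 : ℂ) * (d i j - d j i), by intro i j; ring⟩
  map_add' a b := by ext i j; simp; ring
  map_smul' t a := by ext i j; simp; ring

theorem exists_mul_of_colSpan_le {k l n : ℕ} {X : Matrix (Fin n) (Fin k) ℂ}
    {Y : Matrix (Fin n) (Fin l) ℂ} (h : colSpan Y ≤ colSpan X) :
    ∃ M : Matrix (Fin k) (Fin l) ℂ, Y = X * M := by
  have h1 : ∀ j, ∃ v : Fin k → ℂ, X *ᵥ v = fun i => Y i j := by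
    intro j
    have : (fun i => Y i j) ∈ colSpan Y := ⟨Pi.single j 1, by ext i; simp⟩
    obtain ⟨v, hv⟩ := h this
    exact ⟨v, hv⟩
  choose v hv using h1
  refine ⟨Matrix.of fun i j => v j i, ?_⟩
  ext i j
  have := congrFun (hv j) i
  simp only [Matrix.mulVec, dotProduct] at this
  simp [Matrix.mul_apply, this]

theorem colSpan_mul_le {k l n : ℕ} (X : Matrix (Fin n) (Fin k) ℂ)
    (M : Matrix (Fin k) (Fin l) ℂ) : colSpan (X * M) ≤ colSpan X := by
  rintro _ ⟨v, rfl⟩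
  exact ⟨M *ᵥ v, by simp [Matrix.mulVec_mulVec]⟩

theorem finrank_colSpan {k n : ℕ} {X : Matrix (Fin n) (Fin k) ℂ}
    {B : Matrix (Fin k) (Fin n) ℂ} (h : B * X = 1) : Module.finrank ℂ (colSpan X) = k := by
  have hinj : Function.Injective X.mulVecLin := by
    intro v w hvw
    have := congrArg (B *ᵥ ·) hvw
    simpa [Matrix.mulVec_mulVec, h] using this
  rw [colSpan, LinearMap.finrank_range_of_inj hinj]
  simp

theorem colSpan_isotropic {k n : ℕ} {X : Matrix (Fin n) (Fin k) ℂ} :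
    (∀ x ∈ colSpan X, ∀ y ∈ colSpan X, x ⬝ᵥ y = 0) ↔ Xᵀ * X = 0 := by
  constructor
  · intro h
    ext i j
    have hm : ∀ j, (fun i => X i j) ∈ colSpan X := fun j => ⟨Pi.single j 1, by ext i; simp⟩
    simpa [Matrix.mul_apply, dotProduct] using h _ (hm i) _ (hm j)
  · rintro h _ ⟨v, rfl⟩ _ ⟨w, rfl⟩
    simp only [Matrix.mulVecLin_apply]
    rw [Matrix.dotProduct_mulVec, ← Matrix.mulVec_transpose, Matrix.mulVec_mulVec, h]
    simp

namespace HypFrame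

variable {k n : ℕ} (F : HypFrame k n)

/-- The basis of the isotropic space with coordinates `z`. -/
def param (z : GrModel k n) : Matrix (Fin n) (Fin k) ℂ :=
  F.A + F.U * Matrix.of z.1
    + F.B * (Matrix.of z.2.1 - (1 / 2 : ℂ) • ((Matrix.of z.1)ᵀ * Matrix.of z.1))

theorem AB : F.Aᵀ * F.B = 1 := by
  have := congrArg Matrix.transpose F.BA
  simpa using this

theorem AU : F.Aᵀ * F.U = 0 := by
  have := congrArg Matrix.transpose F.UA
  simpa using this

theorem BU : F.Bᵀ * F.U = 0 := by
  have := congrArg Matrix.transpose F.UB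
  simpa using this

theorem B_param (z) : F.Bᵀ * F.param z = 1 := by
  simp [param, Matrix.mul_add, ← Matrix.mul_assoc, F.BA, F.BB, F.BU]

theorem U_param (z) : F.Uᵀ * F.param z = Matrix.of z.1 := by
  simp [param, Matrix.mul_add, ← Matrix.mul_assoc, F.UA, F.UB, F.UU]

theorem A_param (z) : F.Aᵀ * F.param z =
    Matrix.of z.2.1 - (1 / 2 : ℂ) • ((Matrix.of z.1)ᵀ * Matrix.of z.1) := by
  simp only [param, Matrix.mul_add, ← Matrix.mul_assoc, F.AA, F.AB, F.AU]
  simp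

theorem decomp (X : Matrix (Fin n) (Fin k) ℂ) :
    X = F.A * (F.Bᵀ * X) + F.B * (F.Aᵀ * X) + F.U * (F.Uᵀ * X) := by
  have := congrArg (· * X) F.complete
  simpa [Matrix.add_mul, Matrix.mul_assoc] using this.symm

theorem gram (X : Matrix (Fin n) (Fin k) ℂ) :
    Xᵀ * X = (F.Bᵀ * X)ᵀ * (F.Aᵀ * X) + (F.Aᵀ * X)ᵀ * (F.Bᵀ * X)
      + (F.Uᵀ * X)ᵀ * (F.Uᵀ * X) := by
  conv_lhs => rw [F.decomp X]
  simp only [Matrix.transpose_add, Matrix.transpose_mul, Matrix.add_mul, Matrix.mul_add]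
  have e1 := F.AA; have e2 := F.AB; have e3 := F.AU; have e4 := F.BA; have e5 := F.BB
  have e6 := F.BU; have e7 := F.UA; have e8 := F.UB; have e9 := F.UU
  have key : ∀ {a b c d : ℕ} (P : Matrix (Fin a) (Fin b) ℂ) (Q : Matrix (Fin b) (Fin n) ℂ)
      (R : Matrix (Fin n) (Fin c) ℂ) (S : Matrix (Fin c) (Fin d) ℂ),
      P * Q * (R * S) = P * (Q * R) * S := by
    intros; simp only [Matrix.mul_assoc]
  simp only [key, e1, e2, e3, e4, e5, e6, e7, e8, e9, Matrix.mul_zero, Matrix.zero_mul,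
    Matrix.mul_one, add_zero, zero_add, Matrix.transpose_transpose]
  simp only [Matrix.mul_assoc]
  abel

theorem skew_transpose (z : GrModel k n) :
    (Matrix.of z.2.1)ᵀ = -Matrix.of z.2.1 := by
  ext i j
  simpa using z.2.2 j i

theorem param_isotropic (z) : (F.param z)ᵀ * F.param z = 0 := by
  rw [F.gram, F.A_param, F.B_param, F.U_param]
  simp only [Matrix.transpose_one, Matrix.one_mul, Matrix.mul_one, Matrix.transpose_sub,
    Matrix.transpose_smul, Matrix.transpose_mul, Matrix.transpose_transpose, skew_transpose]
  module

/-- The point with coordinates `z`. -/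
def point (z : GrModel k n) : IsoGr k n :=
  ⟨colSpan (F.param z), finrank_colSpan (F.B_param z),
    colSpan_isotropic.2 (F.param_isotropic z)⟩

/-- The domain of the chart: the isotropic spaces that are transversal to `P' ⊕ U`. -/
def dom : Set (IsoGr k n) :=
  {p | ∃ X : Matrix (Fin n) (Fin k) ℂ, colSpan X = p.1 ∧ F.Bᵀ * X = 1}

/-- The coordinates determined by a normalised basis of an isotropic space. -/
def coordOf (X : Matrix (Fin n) (Fin k) ℂ) : GrModel k n :=
  (fun i j => (F.Uᵀ * X) i j, skewPart k (fun i j => (F.Aᵀ * X) i j))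

open scoped Classical in
/-- The coordinates of a point. -/
def coord (p : IsoGr k n) : GrModel k n :=
  if h : p ∈ F.dom then F.coordOf h.choose else 0

theorem coord_eq {p : IsoGr k n} {X : Matrix (Fin n) (Fin k) ℂ} (h : colSpan X = p.1)
    (hX : F.Bᵀ * X = 1) : F.coord p = F.coordOf X := by
  have hp : p ∈ F.dom := ⟨X, h, hX⟩
  rw [coord, dif_pos hp]
  obtain ⟨M, hM⟩ := exists_mul_of_colSpan_le (X := X) (Y := hp.choose)
    (by rw [hp.choose_spec.1, h])
  have h2 := hp.choose_spec.2
  rw [hM, ← Matrix.mul_assoc, hX, Matrix.one_mul] at h2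
  rw [h2, Matrix.mul_one] at hM
  rw [hM]

theorem coordOf_param (z) : F.coordOf (F.param z) = z := by
  refine Prod.ext ?_ ?_
  · simp [coordOf, U_param]
  · ext i j
    have h1 := z.2.2 i j
    simp only [coordOf, A_param, skewPart]
    have hs : ((Matrix.of z.1)ᵀ * Matrix.of z.1) j i = ((Matrix.of z.1)ᵀ * Matrix.of z.1) i j := by
      simp [Matrix.mul_apply, mul_comm]
    simp only [LinearMap.coe_mk, AddHom.coe_mk, Matrix.sub_apply, Matrix.smul_apply, hs,
      Matrix.of_apply]
    rw [h1]; ring_nf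

theorem param_coordOf {X : Matrix (Fin n) (Fin k) ℂ} (hX : F.Bᵀ * X = 1) (h0 : Xᵀ * X = 0) :
    F.param (F.coordOf X) = X := by
  have hg := F.gram X
  rw [h0, hX] at hg
  conv_rhs => rw [F.decomp X, hX]
  have hU : Matrix.of (F.coordOf X).1 = F.Uᵀ * X := by ext i j; simp [coordOf]
  have hA : Matrix.of (F.coordOf X).2.1
      - (1 / 2 : ℂ) • ((F.Uᵀ * X)ᵀ * (F.Uᵀ * X)) = F.Aᵀ * X := by
    have hs : Matrix.of (F.coordOf X).2.1
        = (1 / 2 : ℂ) • (F.Aᵀ * X - (F.Aᵀ * X)ᵀ) := by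
      ext i j; simp [coordOf, skewPart, -Matrix.transpose_mul]
    have hu : (F.Uᵀ * X)ᵀ * (F.Uᵀ * X) = -(F.Aᵀ * X + (F.Aᵀ * X)ᵀ) := by
      simp only [Matrix.transpose_one, Matrix.one_mul, Matrix.mul_one] at hg
      exact eq_neg_of_add_eq_zero_right hg.symm
    rw [hs, hu]; module
  rw [param, hU, hA, Matrix.mul_one]
  abel

/-- The chart of `Gr_k^0(n)` given by an adapted basis of `ℂⁿ`. -/
def chart : PartialEquiv (IsoGr k n) (GrModel k n) where
  toFun := F.coord
  invFun := F.point
  source := F.dom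
  target := Set.univ
  map_source' := fun _ _ => Set.mem_univ _
  map_target' := fun z _ => ⟨F.param z, rfl, F.B_param z⟩
  left_inv' := by
    rintro p ⟨X, hX, hB⟩
    rw [F.coord_eq hX hB]
    apply Subtype.ext
    have h0 : Xᵀ * X = 0 := colSpan_isotropic.1 (by rw [hX]; exact p.2.2)
    simp only [point, F.param_coordOf hB h0, hX]
  right_inv' := fun z _ => by
    rw [F.coord_eq (p := F.point z) (X := F.param z) rfl (F.B_param z), coordOf_param]

variable (F' : HypFrame k n)

theorem point_mem_dom (z) : F.point z ∈ F'.dom ↔ (F'.Bᵀ * F.param z).det ≠ 0 := by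
  constructor
  · rintro ⟨X, hX, hB⟩
    obtain ⟨M, hM⟩ := exists_mul_of_colSpan_le (X := F.param z) (Y := X) (by rw [hX]; rfl)
    rw [hM, ← Matrix.mul_assoc] at hB
    have := congrArg Matrix.det hB
    rw [Matrix.det_mul, Matrix.det_one] at this
    exact left_ne_zero_of_mul_eq_one this
  · intro h
    have hu : IsUnit (F'.Bᵀ * F.param z).det := isUnit_iff_ne_zero.2 h
    refine ⟨F.param z * (F'.Bᵀ * F.param z)⁻¹, ?_, ?_⟩
    · apply le_antisymm (colSpan_mul_le _ _)
      have : F.param z = F.param z * (F'.Bᵀ * F.param z)⁻¹ * (F'.Bᵀ * F.param z) := by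
        rw [Matrix.mul_assoc, Matrix.nonsing_inv_mul _ hu, Matrix.mul_one]
      change colSpan (F.param z) ≤ _
      conv_lhs => rw [this]
      exact colSpan_mul_le _ _
    · rw [← Matrix.mul_assoc, Matrix.mul_nonsing_inv _ hu]

theorem transition_source :
    (F.chart.symm.trans F'.chart).source = {z | (F'.Bᵀ * F.param z).det ≠ 0} := by
  ext z
  simp only [PartialEquiv.trans_source, PartialEquiv.symm_source, Set.mem_inter_iff,
    Set.mem_preimage, Set.mem_ofPred_eq, ← point_mem_dom]
  exact ⟨fun h => h.2, fun h => ⟨Set.mem_univ _, h⟩⟩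

theorem transition_apply {z} (h : (F'.Bᵀ * F.param z).det ≠ 0) :
    F'.coord (F.point z) = F'.coordOf (F.param z * (F'.Bᵀ * F.param z)⁻¹) := by
  have hu : IsUnit (F'.Bᵀ * F.param z).det := isUnit_iff_ne_zero.2 h
  apply F'.coord_eq
  · apply le_antisymm (colSpan_mul_le _ _)
    have : F.param z = F.param z * (F'.Bᵀ * F.param z)⁻¹ * (F'.Bᵀ * F.param z) := by
      rw [Matrix.mul_assoc, Matrix.nonsing_inv_mul _ hu, Matrix.mul_one]
    change colSpan (F.param z) ≤ _
    conv_lhs => rw [this]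
    exact colSpan_mul_le _ _
  · rw [← Matrix.mul_assoc, Matrix.mul_nonsing_inv _ hu]

theorem contDiff_param (i j) : ContDiff ℂ ω (fun z : GrModel k n => F.param z i j) := by
  have h1 : ∀ i j, ContDiff ℂ ω (fun z : GrModel k n => z.1 i j) := fun i j =>
    contDiff_pi.1 (contDiff_pi.1 contDiff_fst i) j
  have h2 : ∀ i j, ContDiff ℂ ω (fun z : GrModel k n => z.2.1 i j) := fun i j =>
    contDiff_pi.1 (contDiff_pi.1 ((skewArrays k).subtypeL.contDiff.comp contDiff_snd) i) j
  simp only [param, Matrix.add_apply, Matrix.mul_apply, Matrix.sub_apply, Matrix.smul_apply,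
    Matrix.of_apply, Matrix.transpose_apply, smul_eq_mul]
  refine (contDiff_const.add (ContDiff.sum fun l _ => contDiff_const.mul (h1 _ _))).add
    (ContDiff.sum fun l _ => contDiff_const.mul ((h2 _ _).sub
      (contDiff_const.mul (ContDiff.sum fun m _ => (h1 _ _).mul (h1 _ _)))))

theorem contDiff_P (i j) :
    ContDiff ℂ ω (fun z : GrModel k n => (F'.Bᵀ * F.param z) i j) := by
  simp only [Matrix.mul_apply]
  exact ContDiff.sum fun l _ => contDiff_const.mul (F.contDiff_param _ _)

theorem contDiff_det {E : Type*} [NormedAddCommGroup E] [NormedSpace ℂ E] {l : ℕ}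
    {P : E → Matrix (Fin l) (Fin l) ℂ} (h : ∀ i j, ContDiff ℂ ω (fun z => P z i j)) :
    ContDiff ℂ ω (fun z => (P z).det) := by
  simp only [Matrix.det_apply']
  exact ContDiff.sum fun σ _ => contDiff_const.mul (contDiff_prod fun i _ => h _ _)

theorem contDiffOn_transition :
    ContDiffOn ℂ ω (fun z => F'.coord (F.point z)) {z | (F'.Bᵀ * F.param z).det ≠ 0} := by
  refine ContDiffOn.congr (f := fun z =>
    F'.coordOf (F.param z * (F'.Bᵀ * F.param z)⁻¹)) ?_ (fun z hz => F.transition_apply F' hz)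
  have hinv : ∀ i j, ContDiffOn ℂ ω (fun z => (F'.Bᵀ * F.param z)⁻¹ i j)
      {z | (F'.Bᵀ * F.param z).det ≠ 0} := by
    intro i j
    simp only [Matrix.inv_def, Matrix.smul_apply, smul_eq_mul, Ring.inverse_eq_inv']
    refine ContDiffOn.mul ((contDiff_det (F.contDiff_P F')).contDiffOn.inv fun z hz => hz) ?_
    apply ContDiff.contDiffOn
    simp only [Matrix.adjugate_apply]
    apply contDiff_det
    intro a b
    by_cases hab : a = j
    · subst hab; simp only [Matrix.updateRow_self]; exact contDiff_const
    · simp only [Matrix.updateRow_ne hab]; exact F.contDiff_P F' a b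
  have hX : ∀ i j, ContDiffOn ℂ ω (fun z => (F.param z * (F'.Bᵀ * F.param z)⁻¹) i j)
      {z | (F'.Bᵀ * F.param z).det ≠ 0} := by
    intro i j
    simp only [Matrix.mul_apply (M := F.param _)]
    exact ContDiffOn.sum fun l _ => (F.contDiff_param _ _).contDiffOn.mul (hinv _ _)
  have hN : ∀ {l : ℕ} (N : Matrix (Fin l) (Fin n) ℂ) (i j), ContDiffOn ℂ ω
      (fun z => (N * (F.param z * (F'.Bᵀ * F.param z)⁻¹)) i j)
      {z | (F'.Bᵀ * F.param z).det ≠ 0} := by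
    intro l N i j
    simp only [Matrix.mul_apply (M := N)]
    exact ContDiffOn.sum fun l _ => contDiffOn_const.mul (hX _ _)
  refine ContDiffOn.prodMk ?_ ?_
  · exact contDiffOn_pi.2 fun i => contDiffOn_pi.2 fun j => hN _ _ _
  · exact (LinearMap.toContinuousLinearMap (skewPart k)).contDiff.comp_contDiffOn
      (contDiffOn_pi.2 fun i => contDiffOn_pi.2 fun j => hN _ _ _)

theorem isOpen_transition_source : IsOpen {z | (F'.Bᵀ * F.param z).det ≠ 0} :=
  isOpen_ne_fun (contDiff_det (F.contDiff_P F')).continuous continuous_const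

end HypFrame

theorem exists_unitary_basis {k n : ℕ} (p : Submodule ℂ (Fin n → ℂ))
    (hp : Module.finrank ℂ p = k) :
    ∃ E : Matrix (Fin n) (Fin k) ℂ, colSpan E = p ∧ Eᴴ * E = 1 := by
  set e := (WithLp.linearEquiv 2 ℂ (Fin n → ℂ)).symm with he
  set q : Submodule ℂ (EuclideanSpace ℂ (Fin n)) := p.map e.toLinearMap with hq
  have hqk : Module.finrank ℂ q = k := by
    rw [hq, LinearEquiv.finrank_map_eq, hp]
  let b := (stdOrthonormalBasis ℂ q).reindex (finCongr hqk)
  refine ⟨Matrix.of fun i j => (b j : EuclideanSpace ℂ (Fin n)) i, ?_, ?_⟩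
  · have hmem : ∀ j, (fun i => (b j : EuclideanSpace ℂ (Fin n)) i) ∈ p := by
      intro j
      obtain ⟨x, hx, hxe⟩ := (b j).2
      have : (fun i => (b j : EuclideanSpace ℂ (Fin n)) i) = x := by
        rw [← hxe]; rfl
      rw [this]; exact hx
    apply le_antisymm
    · rintro _ ⟨v, rfl⟩
      have : (Matrix.of fun i j => (b j : EuclideanSpace ℂ (Fin n)) i).mulVecLin v
          = ∑ j, v j • (fun i => (b j : EuclideanSpace ℂ (Fin n)) i) := by
        ext i; simp [Matrix.mulVec, dotProduct, mul_comm]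
      rw [this]
      exact Submodule.sum_mem _ fun j _ => Submodule.smul_mem _ _ (hmem j)
    · intro x hx
      let y : q := ⟨e x, x, hx, rfl⟩
      refine ⟨fun j => b.repr y j, ?_⟩
      have h := congrArg (fun t : q => (t : EuclideanSpace ℂ (Fin n))) (b.sum_repr y)
      ext i
      have h2 := congrArg (fun t : EuclideanSpace ℂ (Fin n) => t i) h
      simpa [Matrix.mulVec, dotProduct, mul_comm, y, he] using h2
  · ext i j
    have h := orthonormal_iff_ite.1 b.orthonormal i j
    rw [Matrix.one_apply, ← h]
    simp [Matrix.mul_apply, PiLp.inner_apply, mul_comm]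

/-- Every isotropic space is the centre of a chart. -/
theorem exists_hypFrame {k n : ℕ} (p : IsoGr k n) : ∃ F : HypFrame k n, colSpan F.A = p.1 := by
  obtain ⟨E, hE, hu⟩ := exists_unitary_basis p.1 p.2.1
  have h0 : Eᵀ * E = 0 := colSpan_isotropic.1 (by rw [hE]; exact p.2.2)
  let r : Fin k ⊕ Fin k → EuclideanSpace ℝ (Fin n) := Sum.elim
    (fun j => WithLp.toLp 2 fun i => √2 * (E i j).re)
    (fun j => WithLp.toLp 2 fun i => √2 * (E i j).im)
  have hre0 : ∀ a b, ∑ i, ((E i a).re * (E i b).re - (E i a).im * (E i b).im) = 0 := by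
    intro a b
    have := congrArg Complex.re (congrFun (congrFun h0 a) b)
    simpa [Matrix.mul_apply] using this
  have him0 : ∀ a b, ∑ i, ((E i a).re * (E i b).im + (E i a).im * (E i b).re) = 0 := by
    intro a b
    have := congrArg Complex.im (congrFun (congrFun h0 a) b)
    simpa [Matrix.mul_apply] using this
  have hre1 : ∀ a b, ∑ i, ((E i a).re * (E i b).re + (E i a).im * (E i b).im)
      = if a = b then 1 else 0 := by
    intro a b
    have := congrArg Complex.re (congrFun (congrFun hu a) b)
    rw [Matrix.one_apply] at this
    simp only [Matrix.mul_apply, Matrix.conjTranspose_apply, Complex.re_sum, RCLike.star_def,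
      Complex.mul_re, Complex.conj_re, Complex.conj_im] at this
    rw [apply_ite Complex.re] at this
    simpa using this
  have him1 : ∀ a b, ∑ i, ((E i a).re * (E i b).im - (E i a).im * (E i b).re) = 0 := by
    intro a b
    have := congrArg Complex.im (congrFun (congrFun hu a) b)
    rw [Matrix.one_apply] at this
    simp only [Matrix.mul_apply, Matrix.conjTranspose_apply, Complex.im_sum, RCLike.star_def,
      Complex.mul_im, Complex.conj_re, Complex.conj_im] at this
    rw [apply_ite Complex.im] at this
    simpa [sub_eq_add_neg] using this
  simp only [Finset.sum_add_distrib, Finset.sum_sub_distrib] at hre0 him0 hre1 him1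
  have h22 : ∀ x y : ℝ, (√2 * x) * (√2 * y) = 2 * (x * y) := by
    intro x y
    have : √2 * √2 = (2 : ℝ) := Real.mul_self_sqrt (by norm_num)
    linear_combination (x * y) * this
  have hr : Orthonormal ℝ r := by
    rw [orthonormal_iff_ite]
    rintro (a | a) (b | b)
    · have e1 := hre0 a b; have e2 := hre1 a b
      simp only [r, Sum.elim_inl, PiLp.inner_apply, RCLike.inner_apply, conj_trivial, h22,
        ← Finset.mul_sum, Sum.inl.injEq]
      simp only [mul_comm (E _ b).re]
      split_ifs at e2 ⊢ <;> linarith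
    · have e1 := him0 a b; have e2 := him1 a b
      simp only [r, Sum.elim_inl, Sum.elim_inr, PiLp.inner_apply, RCLike.inner_apply,
        conj_trivial, h22, ← Finset.mul_sum, reduceCtorEq, if_false]
      simp only [mul_comm (E _ b).im]
      linarith
    · have e1 := him0 a b; have e2 := him1 a b
      simp only [r, Sum.elim_inl, Sum.elim_inr, PiLp.inner_apply, RCLike.inner_apply,
        conj_trivial, h22, ← Finset.mul_sum, reduceCtorEq, if_false]
      simp only [mul_comm (E _ b).re]
      linarith
    · have e1 := hre0 a b; have e2 := hre1 a b
      simp only [r, Sum.elim_inr, PiLp.inner_apply, RCLike.inner_apply, conj_trivial, h22,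
        ← Finset.mul_sum, Sum.inr.injEq]
      simp only [mul_comm (E _ b).im]
      split_ifs at e2 ⊢ <;> linarith
  have hcard : 2 * k ≤ n := by
    have := hr.linearIndependent.fintype_card_le_finrank
    simp at this; omega
  let v : (Fin k ⊕ Fin k) ⊕ Fin (n - 2 * k) → EuclideanSpace ℝ (Fin n) := Sum.elim r 0
  have hv : Orthonormal ℝ ((Set.range Sum.inl).domRestrict v) := by
    let f : Set.range (Sum.inl : Fin k ⊕ Fin k → (Fin k ⊕ Fin k) ⊕ Fin (n - 2 * k)) → Fin k ⊕ Fin k :=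
      fun x => x.2.choose
    have hf : ∀ x, Sum.inl (f x) = x.1 := fun x => x.2.choose_spec
    have hfi : Function.Injective f := fun x y hxy => Subtype.ext (by rw [← hf x, hxy, hf y])
    have : (Set.range Sum.inl).domRestrict v = r ∘ f := by
      funext x
      change v x.1 = r (f x)
      rw [← hf x]; rfl
    rw [this]; exact hr.comp f hfi
  obtain ⟨b, hb⟩ := hv.exists_orthonormalBasis_extension_of_card_eq (by simp; omega)
  have hb1 : ∀ j i, b (Sum.inl (Sum.inl j)) i = √2 * (E i j).re := fun j i => by
    rw [hb _ ⟨_, rfl⟩]; rfl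
  have hb2 : ∀ j i, b (Sum.inl (Sum.inr j)) i = √2 * (E i j).im := fun j i => by
    rw [hb _ ⟨_, rfl⟩]; rfl
  let O : Matrix (Fin n) ((Fin k ⊕ Fin k) ⊕ Fin (n - 2 * k)) ℝ := Matrix.of fun i x => b x i
  have hO : Oᵀ * O = 1 := by
    ext x y
    have h := orthonormal_iff_ite.1 b.orthonormal x y
    rw [Matrix.one_apply, ← h]
    simp [O, Matrix.mul_apply, PiLp.inner_apply, mul_comm]
  have hO' : O * Oᵀ = 1 := (Matrix.mul_eq_one_comm_of_card_eq _ _ _ (by simp; omega)).1 hO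
  let U : Matrix (Fin n) (Fin (n - 2 * k)) ℂ := Matrix.of fun i j => (b (Sum.inr j) i : ℂ)
  have hUre : ∀ a j, ∑ i, b (Sum.inr a) i * (E i j).re = 0 := by
    intro a j
    have h := congrFun (congrFun hO (Sum.inr a)) (Sum.inl (Sum.inl j))
    simp only [Matrix.mul_apply, Matrix.transpose_apply, O, Matrix.of_apply, hb1,
      Matrix.one_apply, reduceCtorEq, if_false] at h
    have h2 : √2 * ∑ i, b (Sum.inr a) i * (E i j).re = 0 := by
      rw [Finset.mul_sum, ← h]; exact Finset.sum_congr rfl fun _ _ => by ring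
    simpa using h2
  have hUim : ∀ a j, ∑ i, b (Sum.inr a) i * (E i j).im = 0 := by
    intro a j
    have h := congrFun (congrFun hO (Sum.inr a)) (Sum.inl (Sum.inr j))
    simp only [Matrix.mul_apply, Matrix.transpose_apply, O, Matrix.of_apply, hb2,
      Matrix.one_apply, reduceCtorEq, if_false] at h
    have h2 : √2 * ∑ i, b (Sum.inr a) i * (E i j).im = 0 := by
      rw [Finset.mul_sum, ← h]; exact Finset.sum_congr rfl fun _ _ => by ring
    simpa using h2
  refine ⟨⟨E, E.map star, U, h0, ?_, ?_, ?_, ?_, ?_, ?_⟩, hE⟩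
  · have := congrArg (fun M : Matrix (Fin k) (Fin k) ℂ => M.map star) h0
    ext i j
    have h3 := congrFun (congrFun this i) j
    simpa [Matrix.mul_apply] using h3
  · rw [← hu]; rfl
  · ext x y
    have h := congrFun (congrFun hO (Sum.inr x)) (Sum.inr y)
    have h2 := congrArg (fun t : ℝ => (t : ℂ)) h
    simp only [Matrix.mul_apply, Matrix.transpose_apply, O, Matrix.of_apply, Matrix.one_apply,
      Sum.inr.injEq, Complex.ofReal_sum, Complex.ofReal_mul] at h2
    simp only [U, Matrix.mul_apply, Matrix.transpose_apply, Matrix.of_apply, Matrix.one_apply]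
    rw [h2]; split_ifs <;> simp
  · ext x y
    apply Complex.ext
    · simpa [U, Matrix.mul_apply] using hUre x y
    · simpa [U, Matrix.mul_apply] using hUim x y
  · ext x y
    apply Complex.ext
    · simpa [U, Matrix.mul_apply] using hUre x y
    · simpa [U, Matrix.mul_apply] using hUim x y
  · ext x y
    have h := congrFun (congrFun hO' x) y
    simp only [Matrix.mul_apply, Matrix.transpose_apply, O, Matrix.of_apply,
      Fintype.sum_sum_type, hb1, hb2, h22, Matrix.one_apply] at h
    simp only [← Finset.mul_sum] at h
    apply Complex.ext
    · simp [U, Matrix.mul_apply, Matrix.one_apply, apply_ite Complex.re,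
        Finset.sum_add_distrib] at h ⊢
      linarith
    · simp only [U, Matrix.add_apply, Matrix.mul_apply, Matrix.transpose_apply,
        Matrix.map_apply, Matrix.of_apply, Matrix.one_apply, Complex.add_im, Complex.im_sum,
        Complex.mul_im, RCLike.star_def, Complex.conj_re, Complex.conj_im, Complex.ofReal_re,
        Complex.ofReal_im, apply_ite Complex.im, Complex.one_im, Complex.zero_im, ite_self,
        mul_zero, zero_mul, add_zero, Finset.sum_const_zero, ← Finset.sum_add_distrib]
      exact Finset.sum_eq_zero fun _ _ => by ring

/-- The atlas of `Gr_k^0(n)`, consisting of the charts given by all the adapted bases. -/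
def grCore (k n : ℕ) : ChartedSpaceCore (GrModel k n) (IsoGr k n) where
  atlas := Set.range HypFrame.chart
  chartAt p := (exists_hypFrame p).choose.chart
  mem_chart_source p := ⟨_, (exists_hypFrame p).choose_spec, HypFrame.BA _⟩
  chart_mem_atlas p := ⟨_, rfl⟩
  open_source := by
    rintro _ _ ⟨F, rfl⟩ ⟨F', rfl⟩
    rw [HypFrame.transition_source]
    exact F.isOpen_transition_source F'
  continuousOn_toFun := by
    rintro _ _ ⟨F, rfl⟩ ⟨F', rfl⟩
    rw [HypFrame.transition_source]
    exact (F.contDiffOn_transition F').continuousOn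

instance instTopologicalSpaceIsoGr (k n : ℕ) : TopologicalSpace (IsoGr k n) :=
  (grCore k n).toTopologicalSpace

instance instChartedSpaceIsoGr (k n : ℕ) : ChartedSpace (GrModel k n) (IsoGr k n) :=
  (grCore k n).toChartedSpace

theorem mem_atlas_iff {k n : ℕ} {e : OpenPartialHomeomorph (IsoGr k n) (GrModel k n)} :
    e ∈ atlas (GrModel k n) (IsoGr k n) ↔ ∃ e' : PartialEquiv (IsoGr k n) (GrModel k n),
      ∃ h : e' ∈ (grCore k n).atlas, e = (grCore k n).openPartialHomeomorph e' h := by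
  change e ∈ (⋃ (e' : PartialEquiv (IsoGr k n) (GrModel k n)) (h : e' ∈ (grCore k n).atlas),
    {(grCore k n).openPartialHomeomorph e' h}) ↔ _
  rw [Set.mem_iUnion]
  refine exists_congr fun e' => ?_
  rw [Set.mem_iUnion]
  exact Iff.rfl

/-- `Gr_k^0(n)` is a complex manifold. -/
instance instIsManifoldIsoGr (k n : ℕ) : IsManifold 𝓘(ℂ, GrModel k n) ω (IsoGr k n) := by
  apply isManifold_of_contDiffOn
  intro e e' he he'
  obtain ⟨_, ⟨F, rfl⟩, rfl⟩ := mem_atlas_iff.1 he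
  obtain ⟨_, ⟨F', rfl⟩, rfl⟩ := mem_atlas_iff.1 he'
  have hs := F.transition_source F'
  refine (F.contDiffOn_transition F').mono ?_
  intro z hz
  rw [← hs]
  exact hz.1

/-! ### The actions of the orthogonal Lie algebras -/

/-- The image of an isotropic space through a complex orthogonal transformation. -/
def IsoGr.move {k n : ℕ} (g : Matrix (Fin n) (Fin n) ℂ) (hg : gᵀ * g = 1) (p : IsoGr k n) :
    IsoGr k n :=
  ⟨p.1.map g.mulVecLin, by
    have hinj : Function.Injective g.mulVecLin := by
      intro v w hvw
      have := congrArg (gᵀ *ᵥ ·) hvw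
      simpa [Matrix.mulVec_mulVec, hg] using this
    exact (Submodule.equivMapOfInjective _ hinj p.1).finrank_eq.symm.trans p.2.1, by
    rintro _ ⟨x, hx, rfl⟩ _ ⟨y, hy, rfl⟩
    simp only [Matrix.mulVecLin_apply]
    rw [Matrix.dotProduct_mulVec, ← Matrix.mulVec_transpose, Matrix.mulVec_mulVec, hg,
      Matrix.one_mulVec]
    exact p.2.2 x hx y hy⟩

/-- `so(n) = so(n, ℂ)`, the complex skew-symmetric matrices. -/
abbrev so (n : ℕ) : LieSubalgebra ℂ (Matrix (Fin n) (Fin n) ℂ) :=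
  LieAlgebra.Orthogonal.so (Fin n) ℂ

theorem exp_orthogonal {n : ℕ} (ξ : so n) (t : ℂ) :
    (NormedSpace.exp (t • (ξ : Matrix (Fin n) (Fin n) ℂ)))ᵀ
      * NormedSpace.exp (t • (ξ : Matrix (Fin n) (Fin n) ℂ)) = 1 := by
  have h : (ξ : Matrix (Fin n) (Fin n) ℂ)ᵀ = -ξ := (LieAlgebra.Orthogonal.mem_so _ _ _).1 ξ.2
  rw [← Matrix.exp_transpose, Matrix.transpose_smul, h, smul_neg, Matrix.exp_neg]
  exact Matrix.nonsing_inv_mul _ ((Matrix.isUnit_iff_isUnit_det _).1 (Matrix.isUnit_exp _))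

/-- The infinitesimal action of `so(n)` on `Gr_k^0(n)`, given through its flows: `t ↦ flow ξ t p`
is the integral curve, starting at `p`, of the holomorphic vector field on `Gr_k^0(n)` induced
by `ξ`. -/
def flow {k n : ℕ} (ξ : so n) (t : ℂ) (p : IsoGr k n) : IsoGr k n :=
  p.move (NormedSpace.exp (t • (ξ : Matrix (Fin n) (Fin n) ℂ))) (exp_orthogonal ξ t)

/-- Let a Lie algebra `𝔤` act on `Gr_k^0(m)` and `Gr_l^0(n)` through the morphisms of Lie algebras
`α : 𝔤 → so(m)` and `β : 𝔤 → so(n)`. A map `f` is `𝔤`-equivariant if, for any `ξ ∈ 𝔤`, it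
intertwines the flows of the vector fields induced by `ξ` (for a holomorphic map this means that
these vector fields are `f`-related). -/
def IsEquivariant {𝔤 : Type*} [LieRing 𝔤] [LieAlgebra ℂ 𝔤] {k l m n : ℕ}
    (α : 𝔤 →ₗ⁅ℂ⁆ so m) (β : 𝔤 →ₗ⁅ℂ⁆ so n) (f : IsoGr k m → IsoGr l n) : Prop :=
  ∀ (ξ : 𝔤) (t : ℂ) (p : IsoGr k m), f (flow (α ξ) t p) = flow (β ξ) t (f p)

/-! ### The Cayley cross product, `g_2` and the spin representation of `so(7)` -/

/-- The Cayley cross product on `ℂ⁷`, the complexified imaginary octonions: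
`e i × e (i + 1) = e (i + 3)`, with indices modulo `7`, together with the cyclic permutations
of these equalities and antisymmetry. -/
def cross (u v : Fin 7 → ℂ) : Fin 7 → ℂ := fun i =>
  (u (i + 1) * v (i + 3) - u (i + 3) * v (i + 1))
  + (u (i + 2) * v (i + 6) - u (i + 6) * v (i + 2))
  + (u (i + 4) * v (i + 5) - u (i + 5) * v (i + 4))

theorem cross_add_left (u u' v) : cross (u + u') v = cross u v + cross u' v := by
  ext i; simp [cross]; ring

theorem cross_add_right (u v v') : cross u (v + v') = cross u v + cross u v' := by
  ext i; simp [cross]; ring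

theorem cross_smul_left (t : ℂ) (u v) : cross (t • u) v = t • cross u v := by
  ext i; simp [cross]; ring

theorem cross_smul_right (t : ℂ) (u v) : cross u (t • v) = t • cross u v := by
  ext i; simp [cross]; ring

/-- `g_2`: the Lie algebra of infinitesimal automorphisms of the Cayley cross product, as a Lie
subalgebra of `so(7)`. -/
def g2 : LieSubalgebra ℂ (so 7) where
  carrier := {ξ | ∀ u v, ξ.1 *ᵥ cross u v = cross (ξ.1 *ᵥ u) v + cross u (ξ.1 *ᵥ v)}
  add_mem' := by
    intro a b ha hb u v
    change (a.1 + b.1) *ᵥ _ = cross ((a.1 + b.1) *ᵥ u) v + cross u ((a.1 + b.1) *ᵥ v)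
    simp only [Matrix.add_mulVec, cross_add_left, cross_add_right]
    rw [ha u v, hb u v]
    abel
  zero_mem' := by
    intro u v
    ext i; simp [cross]
  smul_mem' := by
    intro t a ha u v
    change (t • a.1) *ᵥ _ = cross ((t • a.1) *ᵥ u) v + cross u ((t • a.1) *ᵥ v)
    simp only [Matrix.smul_mulVec, cross_smul_left, cross_smul_right]
    rw [ha u v, smul_add]
  lie_mem' := by
    intro a b ha hb u v
    have hsub : ∀ u u' v, cross (u - u') v = cross u v - cross u' v := by
      intro u u' v; ext i; simp [cross]; ring
    have hsub' : ∀ u v v', cross u (v - v') = cross u v - cross u v' := by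
      intro u v v'; ext i; simp [cross]; ring
    simp only [LieSubalgebra.coe_bracket, Ring.lie_def, Matrix.sub_mulVec,
      ← Matrix.mulVec_mulVec, hsub, hsub']
    rw [hb u v, ha u v, Matrix.mulVec_add, Matrix.mulVec_add, ha, ha, hb, hb]
    abel

/-- Multiplication of the complexified octonions `ℂ⁸ = ℂ ⊕ ℂ⁷` by an imaginary octonion on the
left: `u · (r, w) = (-⟨u, w⟩, r u + u × w)`. As `u · (u · s) = -⟨u, u⟩ s`, this makes `ℂ⁸` an
irreducible representation of the Clifford algebra of `ℂ⁷`. -/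
def octMul (u : Fin 7 → ℂ) (s : Fin 8 → ℂ) : Fin 8 → ℂ :=
  Fin.cons (-(u ⬝ᵥ Fin.tail s)) (s 0 • u + cross u (Fin.tail s))

/-- The matrix of the multiplication on the left by the `i`-th imaginary unit. -/
def gam (i : Fin 7) : Matrix (Fin 8) (Fin 8) ℂ :=
  Matrix.of fun a b => octMul (Pi.single i 1) (Pi.single b 1) a

/-- The (integral) entries of `gam`. -/
def gamZ (i : Fin 7) (a b : Fin 8) : ℤ :=
  let u : Fin 7 → ℤ := Pi.single i 1
  let s : Fin 8 → ℤ := Pi.single b 1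
  let v : Fin 7 → ℤ := Fin.tail s
  (Fin.cons (-(u ⬝ᵥ v)) (fun j => s 0 * u j + ((u (j + 1) * v (j + 3) - u (j + 3) * v (j + 1))
    + (u (j + 2) * v (j + 6) - u (j + 6) * v (j + 2))
    + (u (j + 4) * v (j + 5) - u (j + 5) * v (j + 4)))) : Fin 8 → ℤ) a

theorem gam_eq (i : Fin 7) (a b : Fin 8) : gam i a b = (gamZ i a b : ℂ) := by
  have hs : ∀ {l : ℕ} (i j : Fin l), (Pi.single i (1 : ℂ) : Fin l → ℂ) j
      = (((Pi.single i (1 : ℤ) : Fin l → ℤ) j : ℤ) : ℂ) := by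
    intro l i j
    by_cases h : j = i
    · subst h; simp
    · simp [h]
  refine Fin.cases ?_ (fun c => ?_) a
  · simp [gam, gamZ, octMul, dotProduct, Fin.tail, hs]
  · simp [gam, gamZ, octMul, cross, Fin.tail, hs]

theorem gamZ_clifford : ∀ i j : Fin 7, ∀ a b : Fin 8,
    (∑ l, gamZ i a l * gamZ j l b) + (∑ l, gamZ j a l * gamZ i l b)
      = if i = j ∧ a = b then -2 else 0 := by
  decide +kernel

theorem gamZ_skew : ∀ i : Fin 7, ∀ a b : Fin 8, gamZ i a b = -gamZ i b a := by
  decide +kernel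

/-- The matrices `gam i` satisfy the Clifford relations. -/
theorem gam_clifford (i j : Fin 7) :
    gam i * gam j + gam j * gam i = if i = j then -2 else 0 := by
  ext a b
  have h := congrArg (Int.cast : ℤ → ℂ) (gamZ_clifford i j a b)
  push_cast at h
  rw [Matrix.add_apply, Matrix.mul_apply, Matrix.mul_apply]
  simp only [gam_eq]
  rw [h]
  have h2 : (-2 : Matrix (Fin 8) (Fin 8) ℂ) a b = if a = b then -2 else 0 := by
    rw [Matrix.neg_apply, Matrix.ofNat_apply]; split_ifs <;> simp
  by_cases hij : i = j
  · simp [hij, h2]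
  · simp [hij]

theorem gam_transpose (i : Fin 7) : (gam i)ᵀ = -gam i := by
  ext a b
  have h := congrArg (Int.cast : ℤ → ℂ) (gamZ_skew i b a)
  rw [Matrix.transpose_apply, Matrix.neg_apply, gam_eq, gam_eq, h]
  push_cast; rfl

/-- The linear map `ξ ↦ -1/4 ∑ i j, ξ i j • (gam i * gam j)`, from matrices of order `7` to the
endomorphisms of the space of spinors. -/
def spinLin : Matrix (Fin 7) (Fin 7) ℂ →ₗ[ℂ] Matrix (Fin 8) (Fin 8) ℂ where
  toFun ξ := (-1 / 4 : ℂ) • ∑ i, ∑ j, ξ i j • (gam i * gam j)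
  map_add' ξ η := by
    simp only [Matrix.add_apply, add_smul, Finset.sum_add_distrib, smul_add]
  map_smul' t ξ := by
    simp only [Matrix.smul_apply, smul_eq_mul, mul_smul, ← Finset.smul_sum, RingHom.id_apply]
    rw [smul_comm]

theorem spinLin_apply (ξ) : spinLin ξ = (-1 / 4 : ℂ) • ∑ i, ∑ j, ξ i j • (gam i * gam j) := rfl

theorem so_apply {n : ℕ} (ξ : so n) (i j) : ξ.1 i j = -ξ.1 j i := by
  have h : ξ.1ᵀ = -ξ.1 := (LieAlgebra.Orthogonal.mem_so _ _ _).1 ξ.2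
  exact congrFun (congrFun h j) i

/-- `[spinLin ξ, gam k] = gam (ξ e_k)`. -/
theorem spinLin_comm_gam (ξ : so 7) (k : Fin 7) :
    spinLin ξ.1 * gam k - gam k * spinLin ξ.1 = ∑ i, ξ.1 i k • gam i := by
  have h1 : ∀ i j, gam i * gam j * gam k - gam k * (gam i * gam j)
      = gam i * (gam j * gam k + gam k * gam j) - (gam i * gam k + gam k * gam i) * gam j := by
    intro i j; noncomm_ring
  have h2 : ∀ i j, gam i * gam j * gam k - gam k * (gam i * gam j)
      = (if j = k then (-2 : ℂ) • gam i else 0) + (if i = k then (2 : ℂ) • gam j else 0) := by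
    intro i j
    rw [h1, gam_clifford, gam_clifford]
    split_ifs <;> simp [two_smul, mul_two, two_mul] <;> abel
  have h3 : spinLin ξ.1 * gam k - gam k * spinLin ξ.1
      = (-1 / 4 : ℂ) • ∑ i, ∑ j, ξ.1 i j • (gam i * gam j * gam k - gam k * (gam i * gam j)) := by
    simp only [spinLin_apply, Matrix.smul_mul, Matrix.mul_smul, Finset.sum_mul, Finset.mul_sum,
      smul_sub, Finset.sum_sub_distrib]
  rw [h3]
  simp only [h2, smul_add, Finset.sum_add_distrib, smul_ite, smul_zero, Finset.sum_ite_eq',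
    Finset.mem_univ, if_true]
  rw [Finset.sum_comm (f := fun i j => if i = k then ξ.1 i j • (2 : ℂ) • gam j else 0)]
  simp only [Finset.sum_ite_eq', Finset.mem_univ, if_true]
  rw [Finset.smul_sum, Finset.smul_sum, ← Finset.sum_add_distrib]
  refine Finset.sum_congr rfl fun i _ => ?_
  rw [so_apply ξ k i]
  module

theorem spinLin_mem (ξ : so 7) : spinLin ξ.1 ∈ so 8 := by
  rw [LieAlgebra.Orthogonal.mem_so, spinLin_apply]
  simp only [Matrix.transpose_smul, Matrix.transpose_sum, Matrix.transpose_mul, gam_transpose,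
    neg_mul_neg]
  rw [Finset.sum_comm, ← smul_neg, ← Finset.sum_neg_distrib]
  congr 1
  refine Finset.sum_congr rfl fun i _ => ?_
  rw [← Finset.sum_neg_distrib]
  refine Finset.sum_congr rfl fun j _ => ?_
  rw [so_apply ξ j i, neg_smul]

theorem spinLin_lie (ξ η : so 7) :
    spinLin (ξ.1 * η.1 - η.1 * ξ.1) = spinLin ξ.1 * spinLin η.1 - spinLin η.1 * spinLin ξ.1 := by
  have h1 : ∀ k l, spinLin ξ.1 * (gam k * gam l) - gam k * gam l * spinLin ξ.1
      = (∑ i, ξ.1 i k • gam i) * gam l + gam k * ∑ i, ξ.1 i l • gam i := by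
    intro k l
    rw [← spinLin_comm_gam, ← spinLin_comm_gam]
    noncomm_ring
  have h2 : spinLin ξ.1 * spinLin η.1 - spinLin η.1 * spinLin ξ.1
      = (-1 / 4 : ℂ) • ∑ k, ∑ l, η.1 k l •
        (spinLin ξ.1 * (gam k * gam l) - gam k * gam l * spinLin ξ.1) := by
    conv_lhs => rw [spinLin_apply η.1]
    simp only [Matrix.smul_mul, Matrix.mul_smul, Finset.sum_mul, Finset.mul_sum,
      smul_sub, Finset.sum_sub_distrib]
  rw [h2, spinLin_apply]
  congr 1
  simp only [h1, smul_add, Finset.sum_add_distrib, Matrix.sub_apply, sub_smul,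
    Finset.sum_sub_distrib, Matrix.mul_apply, Finset.sum_smul, Finset.sum_mul, Finset.mul_sum,
    Finset.smul_sum, Matrix.smul_mul, Matrix.mul_smul, smul_smul]
  rw [sub_eq_add_neg]
  congr 1
  · -- both sides are sums over `i`, `k`, `l` of `ξ i k * η k l • gam i * gam l`
    calc _ = ∑ i, ∑ k, ∑ l, (ξ.1 i k * η.1 k l) • (gam i * gam l) :=
          Finset.sum_congr rfl fun i _ => Finset.sum_comm
      _ = ∑ k, ∑ i, ∑ l, (ξ.1 i k * η.1 k l) • (gam i * gam l) := Finset.sum_comm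
      _ = ∑ k, ∑ l, ∑ i, (ξ.1 i k * η.1 k l) • (gam i * gam l) :=
          Finset.sum_congr rfl fun k _ => Finset.sum_comm
      _ = _ := by simp only [mul_comm]
  · rw [← Finset.sum_neg_distrib]
    refine Finset.sum_congr rfl fun k _ => ?_
    rw [← Finset.sum_neg_distrib, Finset.sum_comm]
    rw [Finset.sum_comm]
    calc _ = ∑ i, ∑ l, (η.1 k l * ξ.1 i l) • (gam k * gam i) := by
          refine Finset.sum_congr rfl fun i _ => ?_
          rw [← Finset.sum_neg_distrib]
          refine Finset.sum_congr rfl fun l _ => ?_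
          rw [so_apply ξ l i, mul_neg, neg_smul, neg_neg]
      _ = _ := Finset.sum_comm

/-- The second exceptional holonomy representation, that is, the (`8`-dimensional) spin
representation of `so(7)` on `ℂ⁸`, with its invariant bilinear form `x ⬝ᵥ y`. -/
def spin : so 7 →ₗ⁅ℂ⁆ so 8 where
  toFun ξ := ⟨spinLin ξ.1, spinLin_mem ξ⟩
  map_add' ξ η := Subtype.ext (spinLin.map_add _ _)
  map_smul' t ξ := Subtype.ext (spinLin.map_smul _ _)
  map_lie' {ξ η} := Subtype.ext (spinLin_lie ξ η)

end

end ExcHol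

namespace ExcHol

noncomputable section

open Filter Topology

/-! ### Points of the isotropic Grassmannians -/

/-! Everything rests on the Clifford multiplication `cliff u` of `ℂ⁷` on `ℂ⁸`, which is left
multiplication by imaginary octonions. A vector and a spinor are related when `cliff u *ᵥ s = 0`,
and `spinorAnn` and `vectorAnn` are the two polars of this relation.

(i) The polar of an isotropic 3-space is an isotropic line (`finrank_spinorAnn_three`, where a
projection of trace 1 is exhibited), and the polar of an isotropic line of spinors is an isotropic
3-space (`finrank_vectorAnn`, by squeezing rank and nullity between isotropy bounds). The Galois
connection `le_vectorAnn_iff` gives inclusions between spaces of equal dimension, so the two maps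
are mutually inverse. Both are kernels of matrices depending holomorphically on the point, hence
holomorphic by `contMDiffAt_of_ker`. Equivariance is the identity `[spin ξ, cliff u] = cliff (ξ u)`
integrated to exponentials (`exp_spin_mulVec_cliff`).

(ii) The imaginary octonions cut out a hyperplane section `Q^5` of `Q^6`, and the embedding is this
inclusion followed by the inverse of (i). It sends the line of `w` to the vectors `u` with `u ⬝ᵥ w =
0` and `cross u w = 0`, conditions that the exponentials of `g_2` preserve.

(iii) An isotropic line of `ℂ⁷` is sent to its polar, of dimension 4 because a nilpotent `cliff w`
has range equal to its kernel (`finrank_spinorAnn_one`).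

The inclusion `Q^5 → Q^6` and the map of (iii) are embeddings because they are injective linear maps
in adapted charts (`isSmoothEmbedding_of_linear`). -/

theorem IsoGr.eq_of_le {k n : ℕ} {p q : IsoGr k n} (h : p.1 ≤ q.1) : p = q :=
  Subtype.ext (Submodule.eq_of_le_of_finrank_eq h (p.2.1.trans q.2.1.symm))

/-- The trace of the completeness relation gives `k + k + (n - 2 * k) = n`; the subtraction being
truncated, this is exactly the inequality. -/
theorem HypFrame.two_mul_le {k n : ℕ} (F : HypFrame k n) : 2 * k ≤ n := by
  have h := congrArg Matrix.trace F.complete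
  rw [Matrix.trace_add, Matrix.trace_add, Matrix.trace_mul_comm F.A, Matrix.trace_mul_comm F.B,
    Matrix.trace_mul_comm F.U, F.BA, F.AB, F.UU] at h
  simp only [Matrix.trace_one, Fintype.card_fin] at h
  have h2 : k + k + (n - 2 * k) = n := by exact_mod_cast h
  omega

theorem two_mul_finrank_le_of_isotropic {n : ℕ} {p : Submodule ℂ (Fin n → ℂ)}
    (h : ∀ x ∈ p, ∀ y ∈ p, x ⬝ᵥ y = 0) : 2 * Module.finrank ℂ p ≤ n :=
  (exists_hypFrame (⟨p, rfl, h⟩ : IsoGr _ n)).choose.two_mul_le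

theorem col_mem_colSpan {k n : ℕ} (X : Matrix (Fin n) (Fin k) ℂ) (j : Fin k) :
    X.col j ∈ colSpan X := ⟨Pi.single j 1, by ext i; simp⟩

theorem colSpan_le_iff {k n : ℕ} {X : Matrix (Fin n) (Fin k) ℂ} {p : Submodule ℂ (Fin n → ℂ)} :
    colSpan X ≤ p ↔ ∀ j, X.col j ∈ p := by
  refine ⟨fun h j => h (col_mem_colSpan X j), ?_⟩
  rintro h _ ⟨v, rfl⟩
  have : X.mulVecLin v = ∑ j, v j • X.col j := by
    ext i; simp [Matrix.mulVec, dotProduct, mul_comm]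
  rw [this]
  exact Submodule.sum_mem _ fun j _ => Submodule.smul_mem _ _ (h j)

/-! ### Holomorphic maps into the isotropic Grassmannians -/

namespace HypFrame

variable {k n : ℕ} (F : HypFrame k n)

/-- The chart given by an adapted basis, as a partial homeomorphism. -/
def homeo : OpenPartialHomeomorph (IsoGr k n) (GrModel k n) :=
  (grCore k n).openPartialHomeomorph F.chart ⟨F, rfl⟩

theorem homeo_mem_maximalAtlas :
    F.homeo ∈ IsManifold.maximalAtlas 𝓘(ℂ, GrModel k n) ω (IsoGr k n) :=
  IsManifold.subset_maximalAtlas (mem_atlas_iff.2 ⟨_, _, rfl⟩)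

theorem contMDiff_point :
    ContMDiff 𝓘(ℂ, GrModel k n) 𝓘(ℂ, GrModel k n) ω F.point := fun z =>
  contMDiffAt_symm_of_mem_maximalAtlas F.homeo_mem_maximalAtlas (x := z) (Set.mem_univ _)

theorem point_mem_dom_self (z) : F.point z ∈ F.dom := ⟨F.param z, rfl, F.B_param z⟩

theorem exists_point_eq {p : IsoGr k n} (hp : p ∈ F.dom) : ∃ z, F.point z = p :=
  ⟨F.homeo p, F.homeo.left_inv hp⟩

theorem mem_dom_of_colSpan {p : IsoGr k n} (h : colSpan F.A = p.1) : p ∈ F.dom :=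
  ⟨F.A, h, F.BA⟩

theorem homeo_point (z) : F.homeo (F.point z) = z := F.homeo.right_inv (Set.mem_univ z)

end HypFrame

theorem exists_hypFrame_mem_dom {k n : ℕ} (p : IsoGr k n) : ∃ F : HypFrame k n, p ∈ F.dom :=
  (exists_hypFrame p).imp fun F hF => F.mem_dom_of_colSpan hF

section Smooth

variable {E : Type*} [NormedAddCommGroup E] [NormedSpace ℂ E]

theorem contDiffAt_mul {ι κ τ : Type*} [Fintype κ] {P : E → Matrix ι κ ℂ} {R : E → Matrix κ τ ℂ}
    {x : E} (hP : ∀ i j, ContDiffAt ℂ ω (fun z => P z i j) x)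
    (hR : ∀ i j, ContDiffAt ℂ ω (fun z => R z i j) x) (i j) :
    ContDiffAt ℂ ω (fun z => (P z * R z) i j) x := by
  simp only [Matrix.mul_apply]
  exact ContDiffAt.sum fun l _ => (hP _ _).mul (hR _ _)

theorem contDiffAt_det {ι : Type*} [Fintype ι] [DecidableEq ι] {P : E → Matrix ι ι ℂ} {x : E}
    (h : ∀ i j, ContDiffAt ℂ ω (fun z => P z i j) x) : ContDiffAt ℂ ω (fun z => (P z).det) x := by
  simp only [Matrix.det_apply']
  exact ContDiffAt.sum fun σ _ => contDiffAt_const.mul (contDiffAt_prod fun i _ => h _ _)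

theorem contDiffAt_inv_matrix {ι : Type*} [Fintype ι] [DecidableEq ι] {P : E → Matrix ι ι ℂ}
    {x : E} (h : ∀ i j, ContDiffAt ℂ ω (fun z => P z i j) x) (hx : (P x).det ≠ 0) (i j) :
    ContDiffAt ℂ ω (fun z => (P z)⁻¹ i j) x := by
  simp only [Matrix.inv_def, Matrix.smul_apply, smul_eq_mul, Ring.inverse_eq_inv']
  refine ((contDiffAt_det h).inv hx).mul ?_
  simp only [Matrix.adjugate_apply]
  apply contDiffAt_det
  intro a b
  by_cases hab : a = j
  · subst hab; simp only [Matrix.updateRow_self]; exact contDiffAt_const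
  · simp only [Matrix.updateRow_ne hab]; exact h a b

/-- A map into `Gr_k^0(n)` is holomorphic if its values admit bases depending holomorphically on
the point. -/
theorem contMDiffAt_of_colSpan {k n : ℕ} {g : E → IsoGr k n} {X : E → Matrix (Fin n) (Fin k) ℂ}
    {x : E} (hX : ∀ i j, ContDiffAt ℂ ω (fun z => X z i j) x)
    (h : ∀ᶠ z in 𝓝 x, colSpan (X z) = (g z).1) :
    ContMDiffAt 𝓘(ℂ, E) 𝓘(ℂ, GrModel k n) ω g x := by
  obtain ⟨F, Y, hY, hBY⟩ := exists_hypFrame_mem_dom (g x)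
  obtain ⟨M, hM⟩ := exists_mul_of_colSpan_le (X := X x) (Y := Y) (by rw [hY, h.self_of_nhds])
  have hP : ∀ i j, ContDiffAt ℂ ω (fun z => (F.Bᵀ * X z) i j) x :=
    contDiffAt_mul (fun _ _ => contDiffAt_const) hX
  have hx : (F.Bᵀ * X x).det ≠ 0 := by
    rw [hM, ← Matrix.mul_assoc] at hBY
    have := congrArg Matrix.det hBY
    rw [Matrix.det_mul, Matrix.det_one] at this
    exact left_ne_zero_of_mul_eq_one this
  -- Right multiplication by the inverse of `F.Bᵀ * X z` normalises the basis without changing its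
  -- span, so that the chart coordinates can be read off.
  have hW := contDiffAt_mul hX (contDiffAt_inv_matrix hP hx)
  have hc : ContDiffAt ℂ ω (fun z => F.coordOf (X z * (F.Bᵀ * X z)⁻¹)) x := by
    have hN : ∀ {l : ℕ} (N : Matrix (Fin l) (Fin n) ℂ) (i j), ContDiffAt ℂ ω
        (fun z => (N * (X z * (F.Bᵀ * X z)⁻¹)) i j) x := fun N =>
      contDiffAt_mul (fun _ _ => contDiffAt_const) hW
    refine ContDiffAt.prodMk ?_ ?_
    · exact contDiffAt_pi.2 fun i => contDiffAt_pi.2 fun j => hN _ _ _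
    · exact (LinearMap.toContinuousLinearMap (skewPart k)).contDiff.contDiffAt.comp x
        (contDiffAt_pi.2 fun i => contDiffAt_pi.2 fun j => hN _ _ _)
  refine (F.contMDiff_point.contMDiffAt.comp x hc.contMDiffAt).congr_of_eventuallyEq ?_
  filter_upwards [h, (contDiffAt_det hP).continuousAt.eventually_ne hx] with z hz hdet
  have hu : IsUnit (F.Bᵀ * X z).det := isUnit_iff_ne_zero.2 hdet
  have hspan : colSpan (X z * (F.Bᵀ * X z)⁻¹) = (g z).1 := by
    rw [← hz]
    apply le_antisymm (colSpan_mul_le _ _)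
    conv_lhs => rw [← Matrix.mul_one (X z), ← Matrix.nonsing_inv_mul _ hu, ← Matrix.mul_assoc]
    exact colSpan_mul_le _ _
  have hone : F.Bᵀ * (X z * (F.Bᵀ * X z)⁻¹) = 1 := by
    rw [← Matrix.mul_assoc, Matrix.mul_nonsing_inv _ hu]
  apply Subtype.ext
  change _ = colSpan (F.param (F.coordOf _))
  rw [F.param_coordOf hone (colSpan_isotropic.1 (by rw [hspan]; exact (g z).2.2)), hspan]

/-- The matrix is positive definite: a vector that it kills lies in the kernel of `T` and is
Hermitian-orthogonal to that same kernel. -/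
theorem det_conjTranspose_mul_add_ne_zero {k n : ℕ} {ι : Type*} [Fintype ι]
    {T : Matrix ι (Fin n) ℂ} {W : Matrix (Fin n) (Fin k) ℂ}
    (hW : colSpan W = LinearMap.ker T.mulVecLin) (hW1 : Wᴴ * W = 1) :
    (Tᴴ * T + W * Wᴴ).det ≠ 0 := by
  rw [Ne, ← Matrix.exists_mulVec_eq_zero_iff]
  rintro ⟨v, hv0, hv⟩
  have hpos : star (T *ᵥ v) ⬝ᵥ (T *ᵥ v) + star (Wᴴ *ᵥ v) ⬝ᵥ (Wᴴ *ᵥ v) = 0 := by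
    have h := congrArg (star v ⬝ᵥ ·) hv
    simp only [Matrix.add_mulVec, ← Matrix.mulVec_mulVec, dotProduct_add,
      dotProduct_zero] at h
    rw [Matrix.star_mulVec, Matrix.star_mulVec, Matrix.conjTranspose_conjTranspose,
      ← Matrix.dotProduct_mulVec, ← Matrix.dotProduct_mulVec]
    exact h
  open scoped ComplexOrder in
  have h3 := (add_eq_zero_iff_of_nonneg (dotProduct_star_self_nonneg (T *ᵥ v))
    (dotProduct_star_self_nonneg (Wᴴ *ᵥ v))).1 hpos
  open scoped ComplexOrder in
  have hT0 : T *ᵥ v = 0 := dotProduct_star_self_eq_zero.1 h3.1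
  open scoped ComplexOrder in
  have hW0 : Wᴴ *ᵥ v = 0 := dotProduct_star_self_eq_zero.1 h3.2
  have hmem : v ∈ colSpan W := by rw [hW]; exact hT0
  obtain ⟨c, rfl⟩ := hmem
  rw [Matrix.mulVecLin_apply, Matrix.mulVec_mulVec, hW1, Matrix.one_mulVec] at hW0
  exact hv0 (by rw [hW0, map_zero])

/-- On the kernel of `T` the invertible matrix coincides with `W * Wᴴ`, so inverting it recovers
each kernel vector from its coefficients `Wᴴ *ᵥ v`. -/
theorem ker_le_colSpan_inv_mul {k n : ℕ} {ι : Type*} [Fintype ι] {S : Matrix (Fin n) ι ℂ}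
    {T : Matrix ι (Fin n) ℂ} {W : Matrix (Fin n) (Fin k) ℂ}
    (h : (S * T + W * Wᴴ).det ≠ 0) :
    LinearMap.ker T.mulVecLin ≤ colSpan ((S * T + W * Wᴴ)⁻¹ * W) := by
  intro v hv
  have hv' : T *ᵥ v = 0 := hv
  refine ⟨Wᴴ *ᵥ v, ?_⟩
  have hMv : (S * T + W * Wᴴ) *ᵥ v = W *ᵥ (Wᴴ *ᵥ v) := by
    simp only [Matrix.add_mulVec, ← Matrix.mulVec_mulVec, hv', Matrix.mulVec_zero, zero_add]
  rw [Matrix.mulVecLin_apply, ← Matrix.mulVec_mulVec, ← hMv, Matrix.mulVec_mulVec,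
    Matrix.nonsing_inv_mul _ (isUnit_iff_ne_zero.2 h), Matrix.one_mulVec]

/-- A map into `Gr_k^0(n)` is holomorphic if its values are the kernels of matrices depending
holomorphically on the point. -/
theorem contMDiffAt_of_ker {k n : ℕ} {ι : Type*} [Fintype ι] {g : E → IsoGr k n}
    {T : E → Matrix ι (Fin n) ℂ} {x : E} (hT : ∀ i j, ContDiffAt ℂ ω (fun z => T z i j) x)
    (h : ∀ z, (g z).1 = LinearMap.ker (T z).mulVecLin) :
    ContMDiffAt 𝓘(ℂ, E) 𝓘(ℂ, GrModel k n) ω g x := by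
  obtain ⟨W, hW, hW1⟩ := exists_unitary_basis (g x).1 (g x).2.1
  -- The conjugate transpose is frozen at `x`; conjugating `T z` would destroy holomorphy.
  have hM : ∀ i j, ContDiffAt ℂ ω (fun z => ((T x)ᴴ * T z + W * Wᴴ) i j) x := fun i j =>
    (contDiffAt_mul (P := fun _ => (T x)ᴴ) (fun _ _ => contDiffAt_const) hT i j).add
      contDiffAt_const
  have hx := det_conjTranspose_mul_add_ne_zero (hW.trans (h x)) hW1
  refine contMDiffAt_of_colSpan (X := fun z => ((T x)ᴴ * T z + W * Wᴴ)⁻¹ * W)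
    (contDiffAt_mul (contDiffAt_inv_matrix hM hx) fun _ _ => contDiffAt_const) ?_
  filter_upwards [(contDiffAt_det hM).continuousAt.eventually_ne hx] with z hz
  refine (Submodule.eq_of_le_of_finrank_le ((h z).trans_le (ker_le_colSpan_inv_mul hz)) ?_).symm
  rw [(g z).2.1]
  exact (LinearMap.finrank_range_le _).trans_eq (Module.finrank_fin_fun ℂ)

end Smooth

/-- A map between isotropic Grassmannians is holomorphic if its expressions in the charts of its
domain are so. -/
theorem contMDiff_of_comp_point {k l m n : ℕ} {f : IsoGr k m → IsoGr l n}
    (h : ∀ F : HypFrame k m,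
      ContMDiff 𝓘(ℂ, GrModel k m) 𝓘(ℂ, GrModel l n) ω fun z => f (F.point z)) :
    ContMDiff 𝓘(ℂ, GrModel k m) 𝓘(ℂ, GrModel l n) ω f := by
  intro p
  obtain ⟨F, hp⟩ := exists_hypFrame_mem_dom p
  have h1 := contMDiffAt_of_mem_maximalAtlas F.homeo_mem_maximalAtlas (x := p) hp
  refine ((h F).contMDiffAt.comp p h1).congr_of_eventuallyEq ?_
  filter_upwards [F.homeo.open_source.mem_nhds hp] with q hq
  exact congrArg f (F.homeo.left_inv hq).symm

/-! ### Embeddings -/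

/-- This is the normal form `z ↦ (z, 0)` required by the definition of an immersion, obtained by
choosing a complement of the range. -/
theorem exists_equiv_prod_of_injective {E E' : Type*} [NormedAddCommGroup E] [NormedSpace ℂ E]
    [NormedAddCommGroup E'] [NormedSpace ℂ E'] [FiniteDimensional ℂ E] [FiniteDimensional ℂ E']
    (L : E →ₗ[ℂ] E') (hL : Function.Injective L) :
    ∃ e : (E × (Fin (Module.finrank ℂ E' - Module.finrank ℂ E) → ℂ)) ≃L[ℂ] E',
      ∀ z, e (z, 0) = L z := by
  obtain ⟨C, hC⟩ := Submodule.exists_isCompl (LinearMap.range L)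
  have hd : Module.finrank ℂ (Fin (Module.finrank ℂ E' - Module.finrank ℂ E) → ℂ)
      = Module.finrank ℂ C := by
    have h1 := Submodule.finrank_add_eq_of_isCompl hC
    rw [LinearMap.finrank_range_of_inj hL] at h1
    simp only [Module.finrank_fin_fun]
    omega
  exact ⟨(((LinearEquiv.ofInjective L hL).prodCongr (LinearEquiv.ofFinrankEq _ _ hd)).trans
    (Submodule.prodEquivOfIsCompl _ _ hC)).toContinuousLinearEquiv, fun z => by simp⟩

/-- A map between isotropic Grassmannians that is, in adapted charts, the restriction of an
injective linear map is an embedding. -/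
theorem isSmoothEmbedding_of_linear {k l m n : ℕ} {f : IsoGr k m → IsoGr l n}
    (h : ∀ p, ∃ (F : HypFrame k m) (G : HypFrame l n) (L : GrModel k m →ₗ[ℂ] GrModel l n),
      p ∈ F.dom ∧ Function.Injective L ∧ (∀ z, f (F.point z) = G.point (L z)) ∧
      ∀ q, f q ∈ G.dom → q ∈ F.dom) :
    Manifold.IsSmoothEmbedding 𝓘(ℂ, GrModel k m) 𝓘(ℂ, GrModel l n) ω f := by
  have himm : Manifold.IsImmersion 𝓘(ℂ, GrModel k m) 𝓘(ℂ, GrModel l n) ω f := by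
    apply Manifold.IsImmersionOfComplement.isImmersion (F := Fin (Module.finrank ℂ (GrModel l n)
      - Module.finrank ℂ (GrModel k m)) → ℂ)
    intro p
    obtain ⟨F, G, L, hp, hL, hf, -⟩ := h p
    obtain ⟨e, he⟩ := exists_equiv_prod_of_injective L hL
    refine Manifold.IsImmersionAtOfComplement.mk_of_charts e F.homeo G.homeo hp ?_
      F.homeo_mem_maximalAtlas G.homeo_mem_maximalAtlas ?_ ?_
    · obtain ⟨z, rfl⟩ := F.exists_point_eq hp
      rw [hf]; exact G.point_mem_dom_self _
    · intro q hq
      obtain ⟨z, rfl⟩ := F.exists_point_eq hq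
      change f _ ∈ G.dom
      rw [hf]; exact G.point_mem_dom_self _
    · intro z _
      change G.homeo (f (F.point z)) = e (z, 0)
      rw [hf, he, G.homeo_point]
  refine ⟨himm, ?_, ?_⟩
  · rw [Topology.isInducing_iff_nhds]
    intro p
    apply le_antisymm
    · exact himm.contMDiff.continuous.continuousAt.tendsto.le_comap
    obtain ⟨F, G, L, hp, hL, hf, hd⟩ := h p
    have hG : f p ∈ G.dom := by
      obtain ⟨z, rfl⟩ := F.exists_point_eq hp
      rw [hf]; exact G.point_mem_dom_self _
    -- The last hypothesis of `h` enters here: a point whose image is near `f p` already lies in the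
    -- chart domain around `p`, where `f` is linear. The same hypothesis gives injectivity below.
    have hev : ∀ᶠ q in comap f (𝓝 (f p)), f q ∈ G.dom :=
      tendsto_comap.eventually (G.homeo.open_source.mem_nhds hG)
    have hLF : ∀ q ∈ F.dom, G.homeo (f q) = L (F.homeo q) := by
      intro q hq
      obtain ⟨z, rfl⟩ := F.exists_point_eq hq
      rw [hf, F.homeo_point, G.homeo_point]
    rw [F.homeo.nhds_eq_comap_inf_principal hp]
    refine le_inf ?_ (le_principal_iff.2 (hev.mono hd))
    -- An injective linear map in finite dimension is a closed embedding, so convergence may be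
    -- tested after applying `L`.
    rw [← tendsto_iff_comap, (LinearMap.isClosedEmbedding_of_injective
      (LinearMap.ker_eq_bot.2 hL)).isInducing.tendsto_nhds_iff]
    rw [← hLF p hp]
    refine ((G.homeo.continuousAt hG).tendsto.comp tendsto_comap).congr' ?_
    exact hev.mono fun q hq => hLF q (hd q hq)
  · intro p q hpq
    obtain ⟨F, G, L, hp, hL, hf, hd⟩ := h p
    obtain ⟨z, rfl⟩ := F.exists_point_eq hp
    have hq : q ∈ F.dom := hd q (by rw [← hpq, hf]; exact G.point_mem_dom_self _)
    obtain ⟨z', rfl⟩ := F.exists_point_eq hq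
    rw [hf, hf] at hpq
    have := congrArg G.homeo hpq
    rw [G.homeo_point, G.homeo_point] at this
    rw [hL this]

section Diffeomorph

variable {E M M' N : Type*} [NormedAddCommGroup E] [NormedSpace ℂ E]
  {E' E'' : Type*} [NormedAddCommGroup E'] [NormedSpace ℂ E']
  [NormedAddCommGroup E''] [NormedSpace ℂ E'']
  [TopologicalSpace M] [ChartedSpace E M]
  [TopologicalSpace M'] [ChartedSpace E' M'] [TopologicalSpace N] [ChartedSpace E'' N]
  [IsManifold 𝓘(ℂ, E'') ω N]

/-- The composition of an embedding with a diffeomorphism is an embedding. -/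
theorem isSmoothEmbedding_diffeomorph_comp {f : M → M'}
    (hf : Manifold.IsSmoothEmbedding 𝓘(ℂ, E) 𝓘(ℂ, E') ω f)
    (Φ : Diffeomorph 𝓘(ℂ, E') 𝓘(ℂ, E'') M' N ω) :
    Manifold.IsSmoothEmbedding 𝓘(ℂ, E) 𝓘(ℂ, E'') ω (Φ ∘ f) := by
  obtain ⟨⟨F, _, _, h⟩, hemb⟩ := hf
  refine ⟨Manifold.IsImmersionOfComplement.isImmersion (F := F) fun x => ?_,
    Φ.toHomeomorph.isEmbedding.comp hemb⟩
  have hx := h x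
  -- The model spaces of the two targets differ; the derivative of `Φ` serves only as a linear
  -- identification between them. The new chart `ψ` is the old one transported by `Φ` and then by
  -- `A`.
  let A : E' ≃L[ℂ] E'' := Φ.mfderivToContinuousLinearEquiv (by simp) (f x)
  let ψ : OpenPartialHomeomorph N E'' := (Φ.symm.toHomeomorph.toOpenPartialHomeomorph.trans
    hx.codChart).trans A.toHomeomorph.toOpenPartialHomeomorph
  have hsrc : ∀ q, q ∈ ψ.source ↔ Φ.symm q ∈ hx.codChart.source := fun q => by
    simp [ψ]
  have hψ : ψ ∈ IsManifold.maximalAtlas 𝓘(ℂ, E'') ω N := by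
    rw [IsManifold.mem_maximalAtlas_iff_contMDiffOn]
    constructor
    · have h1 := contMDiffOn_of_mem_maximalAtlas hx.codChart_mem_maximalAtlas
      exact A.contDiff.contMDiff.comp_contMDiffOn
        (h1.comp Φ.symm.contMDiff.contMDiffOn fun q hq => (hsrc q).1 hq)
    · have h1 := contMDiffOn_symm_of_mem_maximalAtlas hx.codChart_mem_maximalAtlas
      refine Φ.contMDiff.comp_contMDiffOn
        (h1.comp A.symm.contDiff.contMDiff.contMDiffOn fun q hq => ?_)
      simpa [ψ] using hq
  refine Manifold.IsImmersionAtOfComplement.mk_of_charts (hx.equiv.trans A) hx.domChart ψ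
    hx.mem_domChart_source ?_ hx.domChart_mem_maximalAtlas hψ ?_ ?_
  · rw [hsrc]
    simpa using hx.mem_codChart_source
  · intro q hq
    rw [Set.mem_preimage, hsrc]
    simpa using hx.source_subset_preimage_source hq
  · intro z hz
    have h1 := hx.writtenInCharts hz
    simp only [Function.comp_apply] at h1 ⊢
    have h2 := congrArg A h1
    simpa [ψ] using h2

end Diffeomorph

/-! ### Clifford multiplication -/

/-- The Clifford multiplication by the vectors of `ℂ⁷` on the space `ℂ⁸` of spinors. -/
def cliff : (Fin 7 → ℂ) →ₗ[ℂ] Matrix (Fin 8) (Fin 8) ℂ := Fintype.linearCombination ℂ gam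

theorem cliff_apply (u) : cliff u = ∑ i, u i • gam i := Fintype.linearCombination_apply ..

theorem cliff_anticomm (u v : Fin 7 → ℂ) :
    cliff u * cliff v + cliff v * cliff u = (-2 * (u ⬝ᵥ v)) • 1 := by
  have h : cliff u * cliff v + cliff v * cliff u
      = ∑ i, ∑ j, (u i * v j) • (gam i * gam j + gam j * gam i) := by
    simp only [cliff_apply, Finset.sum_mul, Finset.mul_sum, smul_add, Finset.sum_add_distrib,
      smul_mul_smul_comm]
    congr 1
    rw [Finset.sum_comm]
    exact Finset.sum_congr rfl fun i _ => Finset.sum_congr rfl fun j _ => by rw [mul_comm]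
  have h2 : (-2 : Matrix (Fin 8) (Fin 8) ℂ) = (-2 : ℂ) • 1 := by
    rw [neg_smul, ofNat_smul_eq_nsmul, nsmul_one]; rfl
  rw [h]
  simp only [gam_clifford, smul_ite, smul_zero, Finset.sum_ite_eq, Finset.mem_univ, if_true, h2,
    smul_smul, ← Finset.sum_smul, dotProduct, Finset.mul_sum]
  congr 1
  exact Finset.sum_congr rfl fun i _ => by ring

theorem cliff_mul_of_orth {u v : Fin 7 → ℂ} (h : u ⬝ᵥ v = 0) :
    cliff u * cliff v = -(cliff v * cliff u) := by
  have := cliff_anticomm u v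
  rw [h, mul_zero, zero_smul] at this
  exact eq_neg_of_add_eq_zero_left this

theorem cliff_mul_self (u : Fin 7 → ℂ) : cliff u * cliff u = (-(u ⬝ᵥ u)) • 1 := by
  have h := congrArg ((1 / 2 : ℂ) • ·) (cliff_anticomm u u)
  simp only [← two_smul ℂ (cliff u * cliff u), smul_smul] at h
  norm_num at h
  rw [h, ← mul_assoc]
  norm_num

theorem cliff_transpose (u) : (cliff u)ᵀ = -cliff u := by
  simp only [cliff_apply, Matrix.transpose_sum, Matrix.transpose_smul, gam_transpose, smul_neg,
    Finset.sum_neg_distrib]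

theorem cliff_dotProduct (u : Fin 7 → ℂ) (s t : Fin 8 → ℂ) :
    (cliff u *ᵥ s) ⬝ᵥ t = -(s ⬝ᵥ (cliff u *ᵥ t)) := by
  rw [Matrix.dotProduct_mulVec, ← Matrix.mulVec_transpose, cliff_transpose, Matrix.neg_mulVec,
    neg_dotProduct, neg_neg]

theorem cliff_mulVec_anticomm (u v : Fin 7 → ℂ) (s : Fin 8 → ℂ) :
    cliff u *ᵥ (cliff v *ᵥ s) + cliff v *ᵥ (cliff u *ᵥ s) = (-2 * (u ⬝ᵥ v)) • s := by
  rw [Matrix.mulVec_mulVec, Matrix.mulVec_mulVec, ← Matrix.add_mulVec, cliff_anticomm,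
    Matrix.smul_mulVec, Matrix.one_mulVec]

/-- The anticommutator with the `i`-th unit vector is the scalar `-2 * u i`. -/
theorem cliff_eq_zero_iff {u : Fin 7 → ℂ} : cliff u = 0 ↔ u = 0 := by
  refine ⟨fun h => funext fun i => ?_, fun h => by rw [h, map_zero]⟩
  have h1 := congrFun (congrFun (cliff_anticomm u (Pi.single i 1)) 0) 0
  simpa [h] using h1

/-- The multiplication by imaginary octonions, as a bilinear map. -/
def octMulBilin : (Fin 7 → ℂ) →ₗ[ℂ] (Fin 8 → ℂ) →ₗ[ℂ] (Fin 8 → ℂ) :=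
  LinearMap.mk₂ ℂ octMul
    (fun u u' s => by
      ext a; refine Fin.cases ?_ (fun c => ?_) a
      · simp [octMul]; ring
      · simp [octMul, cross_add_left]; ring)
    (fun t u s => by
      ext a; refine Fin.cases ?_ (fun c => ?_) a
      · simp [octMul]
      · simp [octMul, cross_smul_left]; ring)
    (fun u s s' => by
      have h : Fin.tail (s + s') = Fin.tail s + Fin.tail s' := rfl
      ext a; refine Fin.cases ?_ (fun c => ?_) a
      · simp [octMul, h]; ring
      · simp [octMul, h, cross_add_right]; ring)
    (fun t u s => by
      have h : Fin.tail (t • s) = t • Fin.tail s := rfl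
      ext a; refine Fin.cases ?_ (fun c => ?_) a
      · simp [octMul, h]
      · simp [octMul, h, cross_smul_right]; ring)

/-- This translates Clifford annihilation into the dot and cross products, which is what `g_2`
preserves. -/
theorem cliff_mulVec (u s) : cliff u *ᵥ s = octMul u s := by
  have h : (Matrix.mulVecBilin ℂ ℂ).comp cliff = octMulBilin := by
    ext i b a
    simp [cliff_apply, octMulBilin, gam, Pi.single_apply]
  exact congrArg (fun β => β u s) h

/-! ### Intertwining of exponentials -/

open scoped Matrix.Norms.Operator in
theorem hasDerivAt_bilin {E F G : Type*} [NormedAddCommGroup E] [NormedSpace ℂ E]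
    [NormedAddCommGroup F] [NormedSpace ℂ F] [NormedAddCommGroup G] [NormedSpace ℂ G]
    [FiniteDimensional ℂ E] [FiniteDimensional ℂ F] (β : E →ₗ[ℂ] F →ₗ[ℂ] G) {a : ℂ → E} {b : ℂ → F}
    {a' : E} {b' : F} {t : ℂ} (ha : HasDerivAt a a' t) (hb : HasDerivAt b b' t) :
    HasDerivAt (fun t => β (a t) (b t)) (β (a t) b' + β a' (b t)) t :=
  (LinearMap.toContinuousBilinearMap β).hasDerivAt_of_bilinear (fun _ => ha) fun _ => hb

open scoped Matrix.Norms.Operator in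
theorem hasDerivAt_exp_smul_mulVec {d : ℕ} (D : Matrix (Fin d) (Fin d) ℂ) {w : ℂ → Fin d → ℂ}
    {w' : Fin d → ℂ} {t : ℂ} (hw : HasDerivAt w w' t) :
    HasDerivAt (fun t : ℂ => NormedSpace.exp (t • D) *ᵥ w t)
      (NormedSpace.exp (t • D) *ᵥ (D *ᵥ w t + w')) t := by
  have h := hasDerivAt_bilin (Matrix.mulVecBilin ℂ ℂ) (hasDerivAt_exp_smul_const (𝕂 := ℂ) D t) hw
  refine h.congr_deriv ?_
  rw [Matrix.mulVec_add, add_comm, Matrix.mulVec_mulVec]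
  rfl

theorem hasDerivAt_exp_smul_mulVec_const {d : ℕ} (D : Matrix (Fin d) (Fin d) ℂ) (w : Fin d → ℂ)
    (t : ℂ) : HasDerivAt (fun t : ℂ => NormedSpace.exp (t • D) *ᵥ w)
      (D *ᵥ (NormedSpace.exp (t • D) *ᵥ w)) t := by
  refine (hasDerivAt_exp_smul_mulVec D (hasDerivAt_const t w)).congr_deriv ?_
  have h : Commute (NormedSpace.exp (t • D)) D :=
    ((Commute.refl D).smul_left t).exp_left
  rw [add_zero, Matrix.mulVec_mulVec, Matrix.mulVec_mulVec, h.eq]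

theorem exp_smul_mul_exp_smul_neg {n : ℕ} (C : Matrix (Fin n) (Fin n) ℂ) (t : ℂ) :
    NormedSpace.exp (t • C) * NormedSpace.exp (t • -C) = 1 := by
  rw [smul_neg, Matrix.exp_neg]
  exact Matrix.mul_nonsing_inv _ ((Matrix.isUnit_iff_isUnit_det _).1 (Matrix.isUnit_exp _))

/-- The solutions of linear differential equations with constant coefficients. -/
theorem eq_exp_smul_mulVec {n : ℕ} {C : Matrix (Fin n) (Fin n) ℂ} {g : ℂ → Fin n → ℂ}
    (hg : ∀ t, HasDerivAt g (C *ᵥ g t) t) (t : ℂ) :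
    NormedSpace.exp (t • C) *ᵥ g 0 = g t := by
  -- Variation of constants: the solution multiplied by the inverse exponential does not move.
  have hk : ∀ t, HasDerivAt (fun t : ℂ => NormedSpace.exp (t • -C) *ᵥ g t) 0 t := fun t =>
    (hasDerivAt_exp_smul_mulVec (-C) (hg t)).congr_deriv (by
      rw [Matrix.neg_mulVec, neg_add_cancel, Matrix.mulVec_zero])
  have hc : NormedSpace.exp (t • -C) *ᵥ g t = NormedSpace.exp ((0 : ℂ) • -C) *ᵥ g 0 :=
    is_const_of_deriv_eq_zero (fun t => (hk t).differentiableAt) (fun t => (hk t).deriv) t 0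
  rw [zero_smul, NormedSpace.exp_zero, Matrix.one_mulVec] at hc
  rw [← hc, Matrix.mulVec_mulVec, exp_smul_mul_exp_smul_neg, Matrix.one_mulVec]

/-- If a bilinear map intertwines infinitesimal actions, then it intertwines their flows. -/
theorem exp_smul_mulVec_bilin {l m n : ℕ} {A : Matrix (Fin l) (Fin l) ℂ}
    {B : Matrix (Fin m) (Fin m) ℂ} {C : Matrix (Fin n) (Fin n) ℂ}
    (β : (Fin l → ℂ) →ₗ[ℂ] (Fin m → ℂ) →ₗ[ℂ] (Fin n → ℂ))
    (h : ∀ u v, C *ᵥ β u v = β (A *ᵥ u) v + β u (B *ᵥ v)) (t : ℂ) (u v) :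
    NormedSpace.exp (t • C) *ᵥ β u v
      = β (NormedSpace.exp (t • A) *ᵥ u) (NormedSpace.exp (t • B) *ᵥ v) := by
  have hg := eq_exp_smul_mulVec (C := C) (g := fun t =>
    β (NormedSpace.exp (t • A) *ᵥ u) (NormedSpace.exp (t • B) *ᵥ v)) (fun t => by
      rw [h, add_comm]
      exact hasDerivAt_bilin β (hasDerivAt_exp_smul_mulVec_const A u t)
        (hasDerivAt_exp_smul_mulVec_const B v t)) t
  simpa only [zero_smul, NormedSpace.exp_zero, Matrix.one_mulVec] using hg

/-- The spin representation is compatible with Clifford multiplication. -/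
theorem exp_spin_mulVec_cliff (ξ : so 7) (t : ℂ) (u s) :
    NormedSpace.exp (t • (spin ξ).1) *ᵥ (cliff u *ᵥ s)
      = cliff (NormedSpace.exp (t • ξ.1) *ᵥ u) *ᵥ (NormedSpace.exp (t • (spin ξ).1) *ᵥ s) := by
  refine exp_smul_mulVec_bilin ((Matrix.mulVecBilin ℂ ℂ).comp cliff) (fun u v => ?_) t u s
  -- The linear extension of `spinLin_comm_gam` from basis vectors to all of `ℂ⁷`.
  have hc : spinLin ξ.1 * cliff u - cliff u * spinLin ξ.1 = cliff (ξ.1 *ᵥ u) := by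
    simp only [cliff_apply, Finset.mul_sum, Finset.sum_mul, ← Finset.sum_sub_distrib,
      Matrix.mul_smul, Matrix.smul_mul, ← smul_sub, spinLin_comm_gam, Finset.smul_sum, smul_smul,
      Matrix.mulVec, dotProduct, Finset.sum_smul]
    rw [Finset.sum_comm]
    simp only [mul_comm]
  change spinLin ξ.1 *ᵥ (cliff u *ᵥ v) = cliff (ξ.1 *ᵥ u) *ᵥ v + cliff u *ᵥ (spinLin ξ.1 *ᵥ v)
  rw [← hc, Matrix.sub_mulVec, Matrix.mulVec_mulVec, Matrix.mulVec_mulVec, sub_add_cancel]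

/-- The cross product, as a bilinear map. -/
def crossBilin : (Fin 7 → ℂ) →ₗ[ℂ] (Fin 7 → ℂ) →ₗ[ℂ] (Fin 7 → ℂ) :=
  LinearMap.mk₂ ℂ cross cross_add_left cross_smul_left cross_add_right cross_smul_right

/-- The elements of `g_2` integrate to automorphisms of the cross product. -/
theorem exp_g2_mulVec_cross (ξ : g2) (t : ℂ) (u v) :
    NormedSpace.exp (t • ξ.1.1) *ᵥ cross u v
      = cross (NormedSpace.exp (t • ξ.1.1) *ᵥ u) (NormedSpace.exp (t • ξ.1.1) *ᵥ v) :=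
  exp_smul_mulVec_bilin crossBilin ξ.2 t u v

/-! ### Spinors annihilated by vectors, and vectors annihilating spinors -/

/-- The spinors annihilated by the Clifford multiplication by the elements of `p`. -/
def spinorAnn (p : Submodule ℂ (Fin 7 → ℂ)) : Submodule ℂ (Fin 8 → ℂ) where
  carrier := {s | ∀ u ∈ p, cliff u *ᵥ s = 0}
  add_mem' ha hb u hu := by rw [Matrix.mulVec_add, ha u hu, hb u hu, add_zero]
  zero_mem' u _ := Matrix.mulVec_zero _
  smul_mem' t a ha u hu := by rw [Matrix.mulVec_smul, ha u hu, smul_zero]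

/-- The vectors whose Clifford multiplication annihilates the elements of `q`. -/
def vectorAnn (q : Submodule ℂ (Fin 8 → ℂ)) : Submodule ℂ (Fin 7 → ℂ) where
  carrier := {u | ∀ s ∈ q, cliff u *ᵥ s = 0}
  add_mem' ha hb s hs := by rw [map_add, Matrix.add_mulVec, ha s hs, hb s hs, add_zero]
  zero_mem' s _ := by rw [map_zero, Matrix.zero_mulVec]
  smul_mem' t a ha s hs := by rw [map_smul, Matrix.smul_mulVec, ha s hs, smul_zero]

/-- The Galois connection of the annihilation relation; applied to `le_rfl` it gives the two
inclusions that make the maps of (i) mutually inverse. -/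
theorem le_vectorAnn_iff {p q} : p ≤ vectorAnn q ↔ q ≤ spinorAnn p :=
  ⟨fun h _ hs _ hu => h hu _ hs, fun h _ hu _ hs => h hs _ hu⟩

theorem mem_spinorAnn_colSpan {k : ℕ} {X : Matrix (Fin 7) (Fin k) ℂ} {s} :
    s ∈ spinorAnn (colSpan X) ↔ ∀ j, cliff (X.col j) *ᵥ s = 0 := by
  refine ⟨fun h j => h _ (col_mem_colSpan X j), fun h => ?_⟩
  have : colSpan X ≤ vectorAnn (ℂ ∙ s) := colSpan_le_iff.2 fun j t ht => by
    obtain ⟨c, rfl⟩ := Submodule.mem_span_singleton.1 ht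
    rw [Matrix.mulVec_smul, h j, smul_zero]
  exact fun u hu => this hu s (Submodule.mem_span_singleton_self s)

theorem mem_vectorAnn_colSpan {k : ℕ} {X : Matrix (Fin 8) (Fin k) ℂ} {u} :
    u ∈ vectorAnn (colSpan X) ↔ ∀ j, cliff u *ᵥ (X.col j) = 0 := by
  refine ⟨fun h j => h _ (col_mem_colSpan X j), fun h => ?_⟩
  have : colSpan X ≤ spinorAnn (ℂ ∙ u) := colSpan_le_iff.2 fun j t ht => by
    obtain ⟨c, rfl⟩ := Submodule.mem_span_singleton.1 ht
    rw [map_smul, Matrix.smul_mulVec, h j, smul_zero]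
  exact fun s hs => this hs u (Submodule.mem_span_singleton_self u)

/-! ### Dimensions and isotropy -/

namespace HypFrame

variable {k n : ℕ} (F : HypFrame k n)

theorem dot_AA (i j) : F.A.col i ⬝ᵥ F.A.col j = 0 := congrFun (congrFun F.AA i) j

theorem dot_BB (i j) : F.B.col i ⬝ᵥ F.B.col j = 0 := congrFun (congrFun F.BB i) j

theorem dot_AB (i j) : F.A.col i ⬝ᵥ F.B.col j = if i = j then 1 else 0 :=
  (congrFun (congrFun F.AB i) j).trans (Matrix.one_apply ..)

end HypFrame

/-- By the Clifford relation `cliff u * cliff v` acts as `-2` on the kernel of `cliff u`, so this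
kernel is contained in the range of `cliff u`. -/
theorem eq_cliff_mulVec {u v : Fin 7 → ℂ} (h : u ⬝ᵥ v = 1) {s} (hs : cliff u *ᵥ s = 0) :
    s = cliff u *ᵥ (cliff v *ᵥ ((-1 / 2 : ℂ) • s)) := by
  have h1 := cliff_mulVec_anticomm u v s
  rw [hs, Matrix.mulVec_zero, add_zero, h] at h1
  rw [Matrix.mulVec_smul, Matrix.mulVec_smul, h1, smul_smul]
  norm_num

/-- Write `s` as `cliff u` of a spinor with `u` in `p` and move the skew matrix `cliff u` onto `t`,
which it kills. A nonzero `u` is needed, whence `NeZero k`. -/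
theorem spinorAnn_isotropic {k : ℕ} [NeZero k] (p : IsoGr k 7) :
    ∀ s ∈ spinorAnn p.1, ∀ t ∈ spinorAnn p.1, s ⬝ᵥ t = 0 := by
  intro s hs t ht
  obtain ⟨F, hF⟩ := exists_hypFrame p
  have hu : F.A.col 0 ∈ p.1 := hF ▸ col_mem_colSpan _ _
  rw [eq_cliff_mulVec (F.dot_AB 0 0) (hs _ hu), cliff_dotProduct, ht _ hu, dotProduct_zero,
    neg_zero]

/-- A nonzero spinor killed by `u` and `v` is killed by their anticommutator, the scalar `-2 * (u ⬝ᵥ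
v)`. -/
theorem vectorAnn_isotropic {q : Submodule ℂ (Fin 8 → ℂ)} (hq : q ≠ ⊥) :
    ∀ u ∈ vectorAnn q, ∀ v ∈ vectorAnn q, u ⬝ᵥ v = 0 := by
  intro u hu v hv
  obtain ⟨s, hs, hs0⟩ := Submodule.exists_mem_ne_zero_of_ne_bot hq
  have h := cliff_mulVec_anticomm u v s
  rw [hu s hs, hv s hs, Matrix.mulVec_zero, Matrix.mulVec_zero, add_zero] at h
  simpa [hs0] using h.symm

/-- Skewness, used on either factor, turns twice the product into minus the pairing of `s` with the
anticommutator applied to `s`, a multiple of `s ⬝ᵥ s`. -/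
theorem dot_cliff_cliff {s : Fin 8 → ℂ} (hs : s ⬝ᵥ s = 0) (u v : Fin 7 → ℂ) :
    (cliff u *ᵥ s) ⬝ᵥ (cliff v *ᵥ s) = 0 := by
  have h1 := cliff_dotProduct u s (cliff v *ᵥ s)
  have h2 := cliff_dotProduct v s (cliff u *ᵥ s)
  rw [dotProduct_comm] at h2
  have h3 := congrArg (s ⬝ᵥ ·) (cliff_mulVec_anticomm u v s)
  simp only [dotProduct_add, dotProduct_smul, hs, smul_zero] at h3
  linear_combination (1 / 2 : ℂ) * (h1 + h2 - h3)

/-- For a spinor `s` spanning `q`, the map `u ↦ cliff u *ᵥ s` has isotropic kernel in `ℂ⁷`, of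
dimension at most 3, and isotropic range in `ℂ⁸`, of dimension at most 4. Their sum is 7, so both
bounds are attained. -/
theorem finrank_vectorAnn (q : Quadric 6) : Module.finrank ℂ (vectorAnn q.1) = 3 := by
  obtain ⟨F, hF⟩ := exists_hypFrame q
  have hq : q.1 ≠ ⊥ := by
    intro h
    have := q.2.1
    rw [h, finrank_bot] at this
    exact zero_ne_one this
  have h1 := two_mul_finrank_le_of_isotropic (vectorAnn_isotropic hq)
  let φ : (Fin 7 → ℂ) →ₗ[ℂ] (Fin 8 → ℂ) := ((Matrix.mulVecBilin ℂ ℂ).comp cliff).flip (F.A.col 0)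
  have hker : LinearMap.ker φ = vectorAnn q.1 := by
    ext u
    rw [← hF, mem_vectorAnn_colSpan, Fin.forall_fin_one]
    exact LinearMap.mem_ker
  have h2 := φ.finrank_range_add_finrank_ker
  have h3 : 2 * Module.finrank ℂ (LinearMap.range φ) ≤ 8 := two_mul_finrank_le_of_isotropic (by
    rintro _ ⟨u, rfl⟩ _ ⟨v, rfl⟩
    exact dot_cliff_cliff (F.dot_AA 0 0) u v)
  rw [hker, Module.finrank_fin_fun] at h2
  omega

theorem commute_cliff_mul {u v w : Fin 7 → ℂ} (h1 : u ⬝ᵥ w = 0) (h2 : v ⬝ᵥ w = 0) :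
    Commute (cliff u * cliff v) (cliff w) := by
  rw [Commute, SemiconjBy, mul_assoc, cliff_mul_of_orth h2, mul_neg, ← mul_assoc,
    cliff_mul_of_orth h1, neg_mul, neg_neg, mul_assoc]

/-- Cyclicity and commutation make the traces with `cliff u * cliff v` and `cliff v * cliff u`
equal, and their sum is `-2` times the trace of `X`. -/
theorem trace_cliff_mul {u v : Fin 7 → ℂ} (h : u ⬝ᵥ v = 1) {X : Matrix (Fin 8) (Fin 8) ℂ}
    (hX : Commute X (cliff u)) :
    (cliff u * cliff v * X).trace = -X.trace := by
  have h1 : (cliff u * cliff v * X).trace = (cliff v * cliff u * X).trace := by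
    rw [mul_assoc, Matrix.trace_mul_comm, mul_assoc, mul_assoc, hX.eq]
  have h2 := congrArg (fun Y => (Y * X).trace) (cliff_anticomm u v)
  simp only [add_mul, Matrix.trace_add, ← h1, h, Matrix.smul_mul, one_mul, Matrix.trace_smul,
    smul_eq_mul] at h2
  linear_combination (1 / 2 : ℂ) * h2

theorem finrank_spinorAnn_three (p : IsoGr 3 7) : Module.finrank ℂ (spinorAnn p.1) = 1 := by
  obtain ⟨F, hF⟩ := exists_hypFrame p
  let a : Fin 3 → Matrix (Fin 8) (Fin 8) ℂ := fun i => cliff (F.A.col i)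
  let b : Fin 3 → Matrix (Fin 8) (Fin 8) ℂ := fun i => cliff (F.B.col i)
  have haa : ∀ i, a i * a i = 0 := fun i => by
    rw [cliff_mul_self, F.dot_AA, neg_zero, zero_smul]
  have hca : ∀ i j, i ≠ j → Commute (a i * b i) (a j) := fun i j hij =>
    commute_cliff_mul (F.dot_AA _ _) (by rw [dotProduct_comm, F.dot_AB, if_neg hij.symm])
  -- Each `a i * b i` acts as `-2` on the annihilated spinors, so the factor `-1 / 8` makes `P` the
  -- identity there. Conversely each `a i` can be brought next to itself and kills the product. The
  -- dimension is then the trace of the projection `P`.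
  let P : Matrix (Fin 8) (Fin 8) ℂ := (-1 / 8 : ℂ) • (a 0 * b 0 * (a 1 * b 1 * (a 2 * b 2)))
  have hb : ∀ s ∈ spinorAnn p.1, ∀ i, (a i * b i) *ᵥ s = (-2 : ℂ) • s := by
    intro s hs i
    have h1 := cliff_mulVec_anticomm (F.A.col i) (F.B.col i) s
    rw [hs (F.A.col i) (hF ▸ col_mem_colSpan _ _), Matrix.mulVec_zero, add_zero, F.dot_AB, if_pos rfl,
      mul_one, Matrix.mulVec_mulVec] at h1
    exact h1
  have hP : LinearMap.IsProj (spinorAnn p.1) P.mulVecLin := by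
    constructor
    · intro s
      rw [← hF, mem_spinorAnn_colSpan]
      intro i
      have h0 : a i * (a 0 * b 0 * (a 1 * b 1 * (a 2 * b 2))) = 0 := by
        fin_cases i
        · change a 0 * _ = 0
          simp only [← mul_assoc, haa, zero_mul]
        · change a 1 * _ = 0
          rw [← mul_assoc, ← (hca 0 1 (by decide)).eq]
          simp only [mul_assoc]
          rw [← mul_assoc (a 1) (a 1), haa, zero_mul, mul_zero, mul_zero]
        · change a 2 * _ = 0
          rw [← mul_assoc, ← (hca 0 2 (by decide)).eq, mul_assoc (a 0 * b 0), ← mul_assoc (a 2),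
            ← (hca 1 2 (by decide)).eq, mul_assoc (a 1 * b 1), ← mul_assoc (a 2), haa, zero_mul,
            mul_zero, mul_zero]
      change a i *ᵥ (P *ᵥ s) = 0
      rw [Matrix.mulVec_mulVec, Matrix.mul_smul, h0, smul_zero, Matrix.zero_mulVec]
    · intro s hs
      change P *ᵥ s = s
      rw [Matrix.smul_mulVec, ← Matrix.mulVec_mulVec s (a 0 * b 0),
        ← Matrix.mulVec_mulVec s (a 1 * b 1), hb s hs,
        Matrix.mulVec_smul, Matrix.mulVec_smul, hb s hs, Matrix.mulVec_smul, hb s hs]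
      simp only [smul_smul]
      norm_num
  have h1 : (a 2 * b 2).trace = -8 := by
    have := trace_cliff_mul (X := 1) ((F.dot_AB 2 2).trans (if_pos rfl)) (Commute.one_left _)
    rw [mul_one] at this
    rw [this, Matrix.trace_one]; simp
  have h2 : (a 1 * b 1 * (a 2 * b 2)).trace = 8 := by
    rw [trace_cliff_mul ((F.dot_AB 1 1).trans (if_pos rfl)) (hca 2 1 (by decide)), h1, neg_neg]
  have h3 : (a 0 * b 0 * (a 1 * b 1 * (a 2 * b 2))).trace = -8 := by
    rw [trace_cliff_mul ((F.dot_AB 0 0).trans (if_pos rfl))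
      ((hca 1 0 (by decide)).mul_left (hca 2 0 (by decide))), h2]
  have h4 := hP.trace
  rw [← Matrix.toLin'_apply', Matrix.trace_toLin'_eq, Matrix.trace_smul, h3] at h4
  norm_num at h4
  exact_mod_cast h4.symm

/-- For an isotropic vector the Clifford multiplication squares to zero, and `eq_cliff_mulVec` gives
the converse inclusion: range and kernel coincide, each being half of `ℂ⁸`. -/
theorem finrank_spinorAnn_one (p : Quadric 5) : Module.finrank ℂ (spinorAnn p.1) = 4 := by
  obtain ⟨F, hF⟩ := exists_hypFrame p
  have hk : LinearMap.ker (cliff (F.A.col 0)).mulVecLin = spinorAnn p.1 := by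
    ext s
    rw [← hF, mem_spinorAnn_colSpan, Fin.forall_fin_one]
    exact LinearMap.mem_ker
  have hr : LinearMap.range (cliff (F.A.col 0)).mulVecLin
      = LinearMap.ker (cliff (F.A.col 0)).mulVecLin := by
    ext s
    constructor
    · rintro ⟨t, rfl⟩
      rw [LinearMap.mem_ker, Matrix.mulVecLin_apply, Matrix.mulVecLin_apply,
        Matrix.mulVec_mulVec, cliff_mul_self, F.dot_AA, neg_zero, zero_smul, Matrix.zero_mulVec]
    · exact fun hs => ⟨_, (eq_cliff_mulVec (F.dot_AB 0 0) hs).symm⟩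
  have h := (cliff (F.A.col 0)).mulVecLin.finrank_range_add_finrank_ker
  rw [hr, hk, Module.finrank_fin_fun] at h
  omega

/-! ### The diffeomorphism between `Gr_3^0(7)` and `Q^6` -/

/-- The line of spinors annihilated by a maximal isotropic subspace of `ℂ⁷`. -/
def pureSpinor (p : IsoGr 3 7) : Quadric 6 :=
  ⟨spinorAnn p.1, finrank_spinorAnn_three p, spinorAnn_isotropic p⟩

/-- The maximal isotropic space of vectors annihilating an isotropic spinor. -/
def annihilator (q : Quadric 6) : IsoGr 3 7 :=
  ⟨vectorAnn q.1, finrank_vectorAnn q, vectorAnn_isotropic fun h => by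
    have := q.2.1
    rw [h, finrank_bot] at this
    exact zero_ne_one this⟩

theorem contMDiff_pureSpinor :
    ContMDiff 𝓘(ℂ, GrModel 3 7) 𝓘(ℂ, GrModel 1 8) ω pureSpinor := by
  refine contMDiff_of_comp_point fun F z => contMDiffAt_of_ker (ι := Fin 3 × Fin 8)
    -- The Clifford matrices of the three basis vectors are stacked into one matrix with 24 rows.
    (T := fun z => Matrix.of fun x b => cliff ((F.param z).col x.1) x.2 b) (fun x b => ?_)
    (fun z => ?_)
  · simp only [cliff_apply, Matrix.of_apply, Matrix.sum_apply, Matrix.smul_apply, smul_eq_mul]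
    exact ContDiffAt.sum fun i _ => (F.contDiff_param _ _).contDiffAt.mul contDiffAt_const
  · ext s
    refine mem_spinorAnn_colSpan.trans ?_
    rw [LinearMap.mem_ker, funext_iff, Prod.forall]
    exact forall_congr' fun j => funext_iff

theorem contMDiff_annihilator :
    ContMDiff 𝓘(ℂ, GrModel 1 8) 𝓘(ℂ, GrModel 3 7) ω annihilator := by
  refine contMDiff_of_comp_point fun F z => contMDiffAt_of_ker (ι := Fin 8)
    -- The matrix of `u ↦ cliff u *ᵥ s`, for the spinor `s` spanning the line.
    (T := fun z => Matrix.of fun a i => (gam i *ᵥ (F.param z).col 0) a) (fun a i => ?_)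
    (fun z => ?_)
  · simp only [Matrix.of_apply, Matrix.mulVec, dotProduct]
    exact ContDiffAt.sum fun i _ => contDiffAt_const.mul (F.contDiff_param _ _).contDiffAt
  · ext u
    refine mem_vectorAnn_colSpan.trans ?_
    rw [Fin.forall_fin_one, LinearMap.mem_ker, Matrix.mulVecLin_apply]
    have : cliff u *ᵥ (F.param z).col 0
        = (Matrix.of fun a i => (gam i *ᵥ (F.param z).col 0) a) *ᵥ u := by
      rw [cliff_apply, Matrix.sum_mulVec]
      ext a
      simp only [Finset.sum_apply, Matrix.smul_mulVec, Pi.smul_apply, smul_eq_mul]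
      simp only [Matrix.mulVec, dotProduct, Matrix.of_apply, mul_comm]
    rw [this]

/-- The pure spinors provide a diffeomorphism from `Gr_3^0(7)` onto `Q^6`. -/
def spinorDiffeomorph : Diffeomorph 𝓘(ℂ, GrModel 3 7) 𝓘(ℂ, GrModel 1 8)
    (IsoGr 3 7) (Quadric 6) ω where
  toFun := pureSpinor
  invFun := annihilator
  left_inv _ := (IsoGr.eq_of_le (le_vectorAnn_iff.2 le_rfl)).symm
  right_inv _ := (IsoGr.eq_of_le (le_vectorAnn_iff.1 le_rfl)).symm
  contMDiff_toFun := contMDiff_pureSpinor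
  contMDiff_invFun := contMDiff_annihilator

theorem map_exp_spinorAnn_le (ξ : so 7) (t : ℂ) (p : Submodule ℂ (Fin 7 → ℂ)) :
    (spinorAnn p).map (NormedSpace.exp (t • (spin ξ).1)).mulVecLin
      ≤ spinorAnn (p.map (NormedSpace.exp (t • ξ.1)).mulVecLin) := by
  rintro _ ⟨s, hs, rfl⟩ _ ⟨u, hu, rfl⟩
  rw [Matrix.mulVecLin_apply, Matrix.mulVecLin_apply, ← exp_spin_mulVec_cliff, hs u hu,
    Matrix.mulVec_zero]

theorem isEquivariant_pureSpinor : IsEquivariant (LieHom.id : so 7 →ₗ⁅ℂ⁆ so 7) spin pureSpinor :=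
  fun ξ t p => (IsoGr.eq_of_le (map_exp_spinorAnn_le ξ t p.1)).symm

/-! ### The hyperplane section of `Q^6` -/

/-- The inclusion of the imaginary octonions into the octonions. -/
def imIncl : Matrix (Fin 8) (Fin 7) ℂ := (1 : Matrix (Fin 8) (Fin 8) ℂ).submatrix id Fin.succ

theorem imIncl_mulVec (w : Fin 7 → ℂ) : imIncl *ᵥ w = Fin.cons 0 w := by
  ext a
  refine Fin.cases ?_ (fun c => ?_) a
  · simp [imIncl, Matrix.mulVec, dotProduct, (Fin.succ_ne_zero _).symm]
  · simp [imIncl, Matrix.mulVec, dotProduct, Matrix.one_apply]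

theorem imIncl_transpose_mul : imInclᵀ * imIncl = 1 := by
  ext i j
  simp [imIncl, Matrix.mul_apply, Matrix.one_apply]

/-- The real and imaginary parts of the octonion product of `u` and `w` are `-(u ⬝ᵥ w)` and `cross u
w`. -/
theorem cliff_imIncl_eq_zero_iff {u w : Fin 7 → ℂ} :
    cliff u *ᵥ (imIncl *ᵥ w) = 0 ↔ u ⬝ᵥ w = 0 ∧ cross u w = 0 := by
  rw [cliff_mulVec, imIncl_mulVec, octMul, Fin.tail_cons, Fin.cons_zero, zero_smul, zero_add]
  constructor
  · intro h
    exact ⟨neg_eq_zero.1 (congrFun h 0), funext fun i => congrFun h i.succ⟩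
  · rintro ⟨h1, h2⟩
    rw [h1, h2, neg_zero]
    exact funext (Fin.cases rfl fun _ => rfl)

/-- The hyperplane section of `Q^6` formed of the lines of imaginary octonions. -/
def imQuadric (p : Quadric 5) : Quadric 6 :=
  ⟨p.1.map imIncl.mulVecLin, by
    have hinj : Function.Injective imIncl.mulVecLin := by
      intro v w hvw
      have := congrArg (imInclᵀ *ᵥ ·) hvw
      simpa [Matrix.mulVec_mulVec, imIncl_transpose_mul] using this
    exact (Submodule.equivMapOfInjective _ hinj p.1).finrank_eq.symm.trans p.2.1, by
    rintro _ ⟨x, hx, rfl⟩ _ ⟨y, hy, rfl⟩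
    rw [Matrix.mulVecLin_apply, Matrix.mulVecLin_apply, Matrix.dotProduct_mulVec,
      ← Matrix.mulVec_transpose, Matrix.mulVec_mulVec, imIncl_transpose_mul, Matrix.one_mulVec]
    exact p.2.2 x hx y hy⟩

theorem imIncl_mul_zero {k : ℕ} (X : Matrix (Fin 7) (Fin k) ℂ) (j) : (imIncl * X) 0 j = 0 :=
  congrFun (imIncl_mulVec (X.col j)) 0

theorem imIncl_mul_succ {k : ℕ} (X : Matrix (Fin 7) (Fin k) ℂ) (i j) :
    (imIncl * X) (Fin.succ i) j = X i j :=
  congrFun (imIncl_mulVec (X.col j)) (Fin.succ i)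

/-- The matrix obtained by adjoining the real unit to a system of imaginary octonions. -/
def consUnit {k : ℕ} (X : Matrix (Fin 7) (Fin k) ℂ) : Matrix (Fin 8) (Fin (k + 1)) ℂ :=
  Matrix.of fun i => Fin.cons (if i = 0 then 1 else 0) ((imIncl * X) i)

theorem consUnit_succ {k : ℕ} (X : Matrix (Fin 7) (Fin k) ℂ) (i j) :
    consUnit X i (Fin.succ j) = (imIncl * X) i j := rfl

theorem consUnit_transpose_mul_imIncl {k l : ℕ} (X : Matrix (Fin 7) (Fin k) ℂ)
    (Y : Matrix (Fin 7) (Fin l) ℂ) (h : Xᵀ * Y = 0) : (consUnit X)ᵀ * (imIncl * Y) = 0 := by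
  ext a b
  rw [Matrix.mul_apply, Fin.sum_univ_succ, imIncl_mul_zero, mul_zero, zero_add]
  simp only [imIncl_mul_succ, Matrix.transpose_apply]
  refine Fin.cases ?_ (fun a => ?_) a
  · exact Finset.sum_eq_zero fun i _ => by simp [consUnit]
  · simp only [consUnit_succ, imIncl_mul_succ]
    exact congrFun (congrFun h a) b

theorem consUnit_transpose_mul_self {k : ℕ} {X : Matrix (Fin 7) (Fin k) ℂ} (h : Xᵀ * X = 1) :
    (consUnit X)ᵀ * consUnit X = 1 := by
  ext a b
  rw [Matrix.mul_apply, Fin.sum_univ_succ]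
  simp only [Matrix.transpose_apply]
  refine Fin.cases ?_ (fun a => ?_) a <;> refine Fin.cases ?_ (fun b => ?_) b
  · simp [consUnit]
  · simp [consUnit, imIncl_mul_zero, (Fin.succ_ne_zero _).symm]
  · simp [consUnit, imIncl_mul_zero]
  · simp only [consUnit_succ, imIncl_mul_succ, imIncl_mul_zero, mul_zero, zero_add]
    refine (congrFun (congrFun h a) b).trans ?_
    simp only [Matrix.one_apply, Fin.succ_inj]

/-- The unit column contributes the projection onto the real line, `1 - imIncl * imInclᵀ`, and the
remaining columns contribute `imIncl * (X * Xᵀ) * imInclᵀ`. -/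
theorem consUnit_mul_transpose {k : ℕ} (X : Matrix (Fin 7) (Fin k) ℂ) :
    consUnit X * (consUnit X)ᵀ = 1 + imIncl * (X * Xᵀ - 1) * imInclᵀ := by
  ext i j
  have h : ∀ Y : Matrix (Fin 7) (Fin 7) ℂ, ∀ i, (imIncl * Y * imInclᵀ) i 0 = 0 := fun Y i => by
    rw [Matrix.mul_assoc, ← Matrix.transpose_transpose Y, ← Matrix.transpose_mul, Matrix.mul_apply]
    simp only [Matrix.transpose_apply, imIncl_mul_zero, mul_zero, Finset.sum_const_zero]
  rw [Matrix.mul_apply, Fin.sum_univ_succ]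
  simp only [Matrix.transpose_apply, Matrix.add_apply, consUnit_succ]
  refine Fin.cases ?_ (fun i => ?_) i <;> refine Fin.cases ?_ (fun j => ?_) j
  · simp [consUnit, imIncl_mul_zero, h]
  · simp [consUnit, imIncl_mul_zero, Matrix.mul_assoc, (Fin.succ_ne_zero _).symm]
  · simp [consUnit, imIncl_mul_zero, h]
  · have h2 : ∀ Y : Matrix (Fin 7) (Fin 7) ℂ, (imIncl * Y * imInclᵀ) i.succ j.succ = Y i j := by
      intro Y
      rw [Matrix.mul_assoc, imIncl_mul_succ, ← Matrix.transpose_transpose Y,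
        ← Matrix.transpose_mul, Matrix.transpose_apply, imIncl_mul_succ]
      rfl
    rw [h2]
    simp only [imIncl_mul_succ]
    simp [consUnit, Matrix.one_apply, Matrix.mul_apply]

/-- The extension of an adapted basis from the imaginary octonions to the octonions. -/
def HypFrame.octonion (F : HypFrame 1 7) : HypFrame 1 8 where
  A := imIncl * F.A
  B := imIncl * F.B
  U := consUnit F.U
  AA := by
    rw [Matrix.transpose_mul, Matrix.mul_assoc, ← Matrix.mul_assoc _ imIncl,
      imIncl_transpose_mul, Matrix.one_mul, F.AA]
  BB := by
    rw [Matrix.transpose_mul, Matrix.mul_assoc, ← Matrix.mul_assoc _ imIncl,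
      imIncl_transpose_mul, Matrix.one_mul, F.BB]
  BA := by
    rw [Matrix.transpose_mul, Matrix.mul_assoc, ← Matrix.mul_assoc _ imIncl,
      imIncl_transpose_mul, Matrix.one_mul, F.BA]
  UU := consUnit_transpose_mul_self F.UU
  UA := consUnit_transpose_mul_imIncl _ _ F.UA
  UB := consUnit_transpose_mul_imIncl _ _ F.UB
  complete := by
    have h : consUnit F.U * (consUnit F.U)ᵀ = _ := consUnit_mul_transpose F.U
    have h2 : F.U * F.Uᵀ - 1 = -(F.A * F.Bᵀ + F.B * F.Aᵀ) := by
      rw [← F.complete]; abel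
    change _ + consUnit F.U * (consUnit F.U)ᵀ = 1
    rw [h, h2]
    simp only [Matrix.transpose_mul, Matrix.mul_neg, Matrix.neg_mul, Matrix.mul_add,
      Matrix.add_mul, Matrix.mul_assoc]
    abel

/-- In the frame `F.octonion` the only new basis vector is the real unit, so in charts the map
merely inserts a zero coordinate. -/
theorem isSmoothEmbedding_imQuadric :
    Manifold.IsSmoothEmbedding 𝓘(ℂ, GrModel 1 7) 𝓘(ℂ, GrModel 1 8) ω imQuadric := by
  refine isSmoothEmbedding_of_linear fun p => ?_
  obtain ⟨F, hF⟩ := exists_hypFrame_mem_dom p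
  let L : GrModel 1 7 →ₗ[ℂ] GrModel 1 8 :=
    { toFun := fun z => ((Fin.cons 0 z.1 : Fin 6 → Fin 1 → ℂ), z.2)
      map_add' := fun z w => Prod.ext (funext (Fin.cases (by simp) fun _ => rfl)) rfl
      map_smul' := fun t z => Prod.ext (funext (Fin.cases (by simp) fun _ => rfl)) rfl }
  refine ⟨F, F.octonion, L, hF, ?_, ?_, ?_⟩
  · intro z w h
    exact Prod.ext (Fin.cons_right_injective (α := fun _ => Fin 1 → ℂ) 0 (congrArg Prod.fst h))
      (Prod.ext_iff.1 h).2
  · intro z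
    have hp : F.octonion.param (L z) = imIncl * F.param z := by
      have hU : consUnit F.U * Matrix.of (L z).1 = imIncl * F.U * Matrix.of z.1 := by
        ext i j
        rw [Matrix.mul_apply, Fin.sum_univ_succ]
        simp [L, consUnit, Matrix.mul_apply (M := imIncl * F.U)]
      have hz : (Matrix.of (L z).1)ᵀ * Matrix.of (L z).1 = (Matrix.of z.1)ᵀ * Matrix.of z.1 := by
        ext i j
        rw [Matrix.mul_apply, Fin.sum_univ_succ]
        simp [L, Matrix.mul_apply]
      change imIncl * F.A + consUnit F.U * Matrix.of (L z).1 + imIncl * F.B * _ = _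
      rw [hU, hz]
      simp only [HypFrame.param, Matrix.mul_add, Matrix.mul_assoc]
      rfl
    apply Subtype.ext
    change (colSpan (F.param z)).map _ = colSpan (F.octonion.param (L z))
    rw [hp, colSpan, colSpan, Matrix.mulVecLin_mul, LinearMap.range_comp]
  · rintro q ⟨X, hX, hBX⟩
    refine ⟨imInclᵀ * X, ?_, ?_⟩
    · rw [colSpan, Matrix.mulVecLin_mul, LinearMap.range_comp]
      change (colSpan X).map _ = _
      rw [hX]
      change (q.1.map _).map _ = _
      rw [← Submodule.map_comp, ← Matrix.mulVecLin_mul, imIncl_transpose_mul,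
        Matrix.mulVecLin_one, Submodule.map_id]
    · rw [← Matrix.mul_assoc, ← Matrix.transpose_mul]
      exact hBX

/-- The `g_2`-equivariant embedding of `Q^5` into `Gr_3^0(7)`. -/
def quadricToGr (p : Quadric 5) : IsoGr 3 7 := annihilator (imQuadric p)

theorem isSmoothEmbedding_quadricToGr :
    Manifold.IsSmoothEmbedding 𝓘(ℂ, GrModel 1 7) 𝓘(ℂ, GrModel 3 7) ω quadricToGr :=
  isSmoothEmbedding_diffeomorph_comp isSmoothEmbedding_imQuadric spinorDiffeomorph.symm

theorem mem_quadricToGr {p : Quadric 5} {u} :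
    u ∈ (quadricToGr p).1 ↔ ∀ w ∈ p.1, u ⬝ᵥ w = 0 ∧ cross u w = 0 := by
  constructor
  · exact fun h w hw => cliff_imIncl_eq_zero_iff.1 (h _ ⟨w, hw, rfl⟩)
  · rintro h _ ⟨w, hw, rfl⟩
    exact cliff_imIncl_eq_zero_iff.2 (h w hw)

/-- The equations `u ⬝ᵥ w = 0` and `cross u w = 0` are preserved by the exponentials of `g_2`, which
are orthogonal and respect the cross product. -/
theorem isEquivariant_quadricToGr : IsEquivariant g2.incl g2.incl quadricToGr := by
  intro ξ t p
  symm
  apply IsoGr.eq_of_le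
  rintro _ ⟨u, hu, rfl⟩
  rw [mem_quadricToGr]
  rintro _ ⟨w, hw, rfl⟩
  obtain ⟨h1, h2⟩ := mem_quadricToGr.1 hu w hw
  constructor
  · rw [Matrix.mulVecLin_apply, Matrix.mulVecLin_apply, Matrix.dotProduct_mulVec,
      ← Matrix.mulVec_transpose, Matrix.mulVec_mulVec, exp_orthogonal, Matrix.one_mulVec, h1]
  · have := exp_g2_mulVec_cross ξ t u w
    rw [h2, Matrix.mulVec_zero] at this
    exact this.symm

/-! ### The embedding of `Q^5` into `Gr_4^0(8)` -/

/-- The maximal isotropic space of spinors annihilated by an isotropic line of `ℂ⁷`. -/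
def quadricToGrSpinor (p : Quadric 5) : IsoGr 4 8 :=
  ⟨spinorAnn p.1, finrank_spinorAnn_one p, spinorAnn_isotropic p⟩

theorem isEquivariant_quadricToGrSpinor :
    IsEquivariant g2.incl (spin.comp g2.incl) quadricToGrSpinor :=
  fun ξ t p => (IsoGr.eq_of_le (map_exp_spinorAnn_le ξ.1 t p.1)).symm

theorem HypFrame.U_mul_transpose_eq_zero (G : HypFrame 4 8) : G.U * G.Uᵀ = 0 := by
  ext i j
  rw [Matrix.mul_apply]
  exact Finset.sum_eq_zero fun a _ => Fin.elim0 a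

/-- A basis of `ℂ⁸` adapted to the decomposition into the kernels of the Clifford multiplications
by two isotropic vectors. -/
theorem exists_hypFrame_cliff {w v : Fin 7 → ℂ} (hw : w ⬝ᵥ w = 0) (hv : v ⬝ᵥ v = 0)
    (hwv : w ⬝ᵥ v = 1) {G : HypFrame 4 8}
    (hG : colSpan G.A = LinearMap.ker (cliff w).mulVecLin) :
    ∃ (H : HypFrame 4 8) (Y : Matrix (Fin 8) (Fin 4) ℂ), H.A = G.A ∧ H.B = cliff v * Y := by
  have hWA : cliff w * G.A = 0 := by
    ext i j
    exact congrFun (hG.le (col_mem_colSpan G.A j)) i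
  have hWW : cliff w * cliff w = 0 := by rw [cliff_mul_self, hw, neg_zero, zero_smul]
  have hVV : cliff v * cliff v = 0 := by rw [cliff_mul_self, hv, neg_zero, zero_smul]
  -- `e` and `f` are the complementary projections onto the kernels of `cliff v` and `cliff w`.
  -- Replacing `G.B` by `e * G.B` keeps the duality with `G.A`, because `e` and `f` are transposes
  -- of each other, and places the dual space in the kernel of `cliff v`.
  set e : Matrix (Fin 8) (Fin 8) ℂ := (-1 / 2 : ℂ) • (cliff v * cliff w) with he
  set f : Matrix (Fin 8) (Fin 8) ℂ := (-1 / 2 : ℂ) • (cliff w * cliff v) with hf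
  have hef : f + e = 1 := by
    rw [he, hf, ← smul_add, cliff_anticomm, hwv, smul_smul]
    norm_num
  have het : eᵀ = f := by
    rw [he, hf, Matrix.transpose_smul, Matrix.transpose_mul, cliff_transpose, cliff_transpose,
      neg_mul_neg]
  have hfe : f * e = 0 := by
    rw [he, hf, Matrix.smul_mul, Matrix.mul_smul, mul_assoc, ← mul_assoc (cliff v), hVV, zero_mul,
      mul_zero, smul_zero, smul_zero]
  have heA : e * G.A = 0 := by
    rw [he, Matrix.smul_mul, Matrix.mul_assoc, hWA, Matrix.mul_zero, smul_zero]
  have hfA : f * G.A = G.A := by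
    have := congrArg (· * G.A) hef
    simpa only [Matrix.add_mul, heA, add_zero, Matrix.one_mul] using this
  obtain ⟨M, hM⟩ : ∃ M, f = G.A * M := exists_mul_of_colSpan_le (by
    rw [hG, hf, ← Matrix.mul_smul]
    refine colSpan_le_iff.2 fun j => ?_
    have : cliff w * (cliff w * ((-1 / 2 : ℂ) • cliff v)) = 0 := by
      rw [← mul_assoc, hWW, zero_mul]
    exact funext fun i => congrFun (congrFun this i) j)
  refine ⟨⟨G.A, e * G.B, G.U, G.AA, ?_, ?_, G.UU, G.UA, ?_, ?_⟩,
    (-1 / 2 : ℂ) • (cliff w * G.B), rfl, ?_⟩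
  · rw [Matrix.transpose_mul, het, Matrix.mul_assoc, ← Matrix.mul_assoc f, hfe, Matrix.zero_mul,
      Matrix.mul_zero]
  · rw [Matrix.transpose_mul, het, Matrix.mul_assoc, hfA, G.BA]
  · ext i
    exact Fin.elim0 i
  · have h1 : G.B * G.Aᵀ = 1 - G.A * G.Bᵀ := by
      rw [← G.complete, G.U_mul_transpose_eq_zero]; abel
    rw [G.U_mul_transpose_eq_zero, add_zero, Matrix.transpose_mul, het, Matrix.mul_assoc, h1,
      Matrix.mul_sub, ← Matrix.mul_assoc e, heA, Matrix.zero_mul, sub_zero, Matrix.mul_one]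
    conv_lhs => enter [1]; rw [hM, ← Matrix.mul_assoc G.Bᵀ, G.BA, Matrix.one_mul, ← hM]
    exact hef
  · change e * G.B = _
    rw [he, Matrix.smul_mul, Matrix.mul_smul, Matrix.mul_assoc]

/-- Let `w` and `v` be the isotropic vectors of the frame at `p`. A nearby line is spanned by `w + u
+ q • v`, with `u` orthogonal to both and `q = -(u ⬝ᵥ u) / 2`. The spinors that it kills are the `a
+ (1 / 2) • cliff v *ᵥ (cliff u *ᵥ a)` with `a` killed by `cliff w`. This is a graph with values in
the kernel of `cliff v`, linear in `u`. -/
theorem isSmoothEmbedding_quadricToGrSpinor :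
    Manifold.IsSmoothEmbedding 𝓘(ℂ, GrModel 1 7) 𝓘(ℂ, GrModel 4 8) ω quadricToGrSpinor := by
  refine isSmoothEmbedding_of_linear fun p => ?_
  obtain ⟨F, hF⟩ := exists_hypFrame p
  obtain ⟨G₀, hG₀⟩ := exists_hypFrame (quadricToGrSpinor p)
  have hker : colSpan G₀.A = LinearMap.ker (cliff (F.A.col 0)).mulVecLin := by
    rw [hG₀]
    ext s
    change s ∈ spinorAnn p.1 ↔ _
    rw [← hF, mem_spinorAnn_colSpan, Fin.forall_fin_one]
    rw [LinearMap.mem_ker]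
    rfl
  have hwv : F.A.col 0 ⬝ᵥ F.B.col 0 = 1 := (F.dot_AB 0 0).trans (if_pos rfl)
  obtain ⟨G, Y, hGA, hGB⟩ := exists_hypFrame_cliff (F.dot_AA 0 0) (F.dot_BB 0 0) hwv hker
  rw [← hGA] at hker
  set W := cliff (F.A.col 0) with hW
  set V := cliff (F.B.col 0) with hV
  have hWW : W * W = 0 := by rw [hW, cliff_mul_self, F.dot_AA, neg_zero, zero_smul]
  have hVV : V * V = 0 := by rw [hV, cliff_mul_self, F.dot_BB, neg_zero, zero_smul]
  have hWV : W * V = (-2 : ℂ) • 1 - V * W := by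
    rw [eq_sub_iff_add_eq, hW, hV, cliff_anticomm, hwv, mul_one]
  have hWA : W * G.A = 0 := by
    ext i j
    exact congrFun (hker.le (col_mem_colSpan G.A j)) i
  have hBV : G.Bᵀ * V = 0 := by
    rw [hGB, Matrix.transpose_mul, hV, cliff_transpose, Matrix.mul_assoc, ← hV, Matrix.neg_mul,
      hVV, neg_zero, Matrix.mul_zero]
  let u : GrModel 1 7 →ₗ[ℂ] (Fin 7 → ℂ) :=
    { toFun := fun z => F.U *ᵥ fun i => z.1 i 0
      map_add' := fun z w => Matrix.mulVec_add _ _ _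
      map_smul' := fun t z => Matrix.mulVec_smul F.U t fun i => z.1 i 0 }
  have huw : ∀ z, u z ⬝ᵥ F.A.col 0 = 0 := fun z => by
    change (F.U *ᵥ _) ⬝ᵥ _ = 0
    rw [dotProduct_comm, Matrix.dotProduct_mulVec, ← Matrix.mulVec_transpose]
    have : F.Uᵀ *ᵥ F.A.col 0 = 0 := funext fun i => congrFun (congrFun F.UA i) 0
    rw [this, zero_dotProduct]
  have huv : ∀ z, u z ⬝ᵥ F.B.col 0 = 0 := fun z => by
    change (F.U *ᵥ _) ⬝ᵥ _ = 0
    rw [dotProduct_comm, Matrix.dotProduct_mulVec, ← Matrix.mulVec_transpose]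
    have : F.Uᵀ *ᵥ F.B.col 0 = 0 := funext fun i => congrFun (congrFun F.UB i) 0
    rw [this, zero_dotProduct]
  have hDW : ∀ z, cliff (u z) * W = -(W * cliff (u z)) := fun z => cliff_mul_of_orth (huw z)
  have hDV : ∀ z, cliff (u z) * V = -(V * cliff (u z)) := fun z => cliff_mul_of_orth (huv z)
  let c : GrModel 1 7 →ₗ[ℂ] (Fin 4 → Fin 4 → ℂ) :=
    { toFun := fun z => (1 / 2 : ℂ) • (G.Aᵀ * (V * cliff (u z) * G.A))
      map_add' := fun z w => by
        rw [map_add, map_add, Matrix.mul_add, Matrix.add_mul, Matrix.mul_add, smul_add]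
        rfl
      map_smul' := fun t z => by
        rw [map_smul, map_smul, Matrix.mul_smul, Matrix.smul_mul, Matrix.mul_smul, smul_comm]
        rfl }
  have hc : ∀ z, Matrix.of (c z) = (1 / 2 : ℂ) • (G.Aᵀ * (V * cliff (u z) * G.A)) := fun z => rfl
  -- `V` and `cliff (u z)` are skew and anticommute, so their product is skew and `skewPart` changes
  -- nothing.
  have hcs : ∀ z, Matrix.of (skewPart 4 (c z)).1 = Matrix.of (c z) := fun z => by
    have h1 : (Matrix.of (c z))ᵀ = -Matrix.of (c z) := by
      rw [hc, Matrix.transpose_smul, Matrix.transpose_mul, Matrix.transpose_mul,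
        Matrix.transpose_mul, Matrix.transpose_transpose, cliff_transpose, hV, cliff_transpose,
        neg_mul_neg, ← hV, hDV, Matrix.mul_neg, Matrix.neg_mul, smul_neg, Matrix.mul_assoc]
    ext i j
    have h2 : c z j i = -c z i j := congrFun (congrFun h1 i) j
    change (1 / 2 : ℂ) * (c z i j - c z j i) = c z i j
    rw [h2]; ring
  have hBc : ∀ z, G.B * Matrix.of (c z) = (1 / 2 : ℂ) • (V * cliff (u z) * G.A) := fun z => by
    have h1 : G.B * G.Aᵀ = 1 - G.A * G.Bᵀ := by
      rw [← G.complete, G.U_mul_transpose_eq_zero]; abel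
    rw [hc, Matrix.mul_smul, ← Matrix.mul_assoc, h1, Matrix.sub_mul, Matrix.one_mul,
      Matrix.mul_assoc G.A, ← Matrix.mul_assoc G.Bᵀ, ← Matrix.mul_assoc G.Bᵀ, hBV,
      Matrix.zero_mul, Matrix.zero_mul, Matrix.mul_zero, sub_zero]
  -- The first factor of the target model is trivial since `8 - 2 * 4 = 0`.
  let L : GrModel 1 7 →ₗ[ℂ] GrModel 4 8 := LinearMap.prod 0 ((skewPart 4).comp c)
  refine ⟨F, G, L, F.mem_dom_of_colSpan hF, ?_, ?_, ?_⟩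
  · rw [injective_iff_map_eq_zero]
    intro z hz
    have h0 : Matrix.of (c z) = 0 := by
      rw [← hcs, show skewPart 4 (c z) = 0 from congrArg Prod.snd hz]; rfl
    have h1 : V * cliff (u z) * G.A = 0 := by
      have := hBc z
      rw [h0, Matrix.mul_zero] at this
      exact (smul_eq_zero.1 this.symm).resolve_left (by norm_num)
    obtain ⟨M, hM⟩ : ∃ M, W = G.A * M := exists_mul_of_colSpan_le (by
      rw [hker]
      exact colSpan_le_iff.2 fun j => funext fun i => congrFun (congrFun hWW i) j)
    have h2 : V * (cliff (u z) * W) = 0 := by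
      conv_lhs => rw [hM]
      rw [← Matrix.mul_assoc, ← Matrix.mul_assoc, h1, Matrix.zero_mul]
    -- As `W * V = -2 - V * W` and `W * cliff (u z) * W = 0`, multiplying `h2` by `W` on the left
    -- cancels `V`; the same relation used on the right then cancels `W` in `h5`.
    have h3 : cliff (u z) * W = 0 := by
      have h4 : (W * V) * (cliff (u z) * W) = 0 := by rw [mul_assoc, h2, mul_zero]
      rw [hWV, sub_mul, mul_assoc V, hDW, mul_neg W, ← mul_assoc W, hWW, zero_mul, neg_zero,
        mul_zero, sub_zero, Matrix.smul_mul, one_mul, ← hDW] at h4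
      exact (smul_eq_zero.1 h4).resolve_left (by norm_num)
    have h5 : cliff (u z) = 0 := by
      have h4 : cliff (u z) * (W * V) = 0 := by rw [← mul_assoc, h3, zero_mul]
      rw [hWV, mul_sub, ← mul_assoc, hDV, neg_mul, mul_assoc, h3, mul_zero, neg_zero, sub_zero,
        Matrix.mul_smul, mul_one] at h4
      exact (smul_eq_zero.1 h4).resolve_left (by norm_num)
    have h6 : F.U *ᵥ (fun i => z.1 i 0) = 0 := cliff_eq_zero_iff.1 h5
    have h7 := congrArg (F.Uᵀ *ᵥ ·) h6
    simp only [Matrix.mulVec_mulVec, F.UU, Matrix.one_mulVec, Matrix.mulVec_zero] at h7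
    refine Prod.ext (funext fun i => funext fun j => ?_) (Subtype.ext (funext fun i =>
      funext fun j => ?_))
    · rw [Subsingleton.elim j 0]
      exact congrFun h7 i
    -- A skew array of order 1 vanishes, so the second coordinate carries no information.
    · have := z.2.2 i j
      rw [Subsingleton.elim j i] at this ⊢
      exact self_eq_neg.1 this
  · intro z
    symm
    apply IsoGr.eq_of_le
    have hp : G.param (L z) = G.A + (1 / 2 : ℂ) • (V * cliff (u z) * G.A) := by
      have h1 : Matrix.of (L z).1 = 0 := rfl
      have h2 : Matrix.of (L z).2.1 = Matrix.of (c z) := hcs z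
      rw [HypFrame.param, h1, h2, Matrix.mul_zero, Matrix.mul_zero, smul_zero, sub_zero, hBc,
        add_zero]
    obtain ⟨q, hq⟩ : ∃ q : ℂ, (F.param z).col 0 = F.A.col 0 + u z + q • F.B.col 0 :=
      ⟨(Matrix.of z.2.1 - (1 / 2 : ℂ) • ((Matrix.of z.1)ᵀ * Matrix.of z.1)) 0 0, by
        ext i
        change (F.A + F.U * Matrix.of z.1 + F.B * (Matrix.of z.2.1
          - (1 / 2 : ℂ) • ((Matrix.of z.1)ᵀ * Matrix.of z.1)) : Matrix (Fin 7) (Fin 1) ℂ) i 0 = _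
        rw [Matrix.add_apply, Matrix.add_apply, Matrix.mul_apply (M := F.B), Fin.sum_univ_one]
        exact congrArg (F.A i 0 + (F.U * Matrix.of z.1) i 0 + ·) (mul_comm _ _)⟩
    have hqu : q = -(1 / 2) * (u z ⬝ᵥ u z) := by
      have h1 : (F.param z).col 0 ⬝ᵥ (F.param z).col 0 = 0 :=
        congrFun (congrFun (F.param_isotropic z) 0) 0
      have h2 := huw z
      have h3 := huv z
      rw [dotProduct_comm] at h2 h3
      simp only [hq, add_dotProduct, dotProduct_add, smul_dotProduct, dotProduct_smul, huw, huv,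
        h2, h3, F.dot_AA, F.dot_BB, hwv, dotProduct_comm (F.B.col 0) (F.A.col 0),
        smul_eq_mul] at h1
      linear_combination (1 / 2 : ℂ) * h1
    have hzero : cliff ((F.param z).col 0) * G.param (L z) = 0 := by
      have e1 : W * (V * cliff (u z) * G.A) = (-2 : ℂ) • (cliff (u z) * G.A) := by
        rw [← Matrix.mul_assoc, ← mul_assoc, hWV, sub_mul, mul_assoc V,
          ← neg_eq_iff_eq_neg.2 (hDW z), Matrix.sub_mul]
        rw [mul_neg, Matrix.neg_mul, Matrix.mul_assoc V, Matrix.mul_assoc _ W, hWA,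
          Matrix.mul_zero, Matrix.mul_zero, neg_zero, sub_zero, Matrix.smul_mul, Matrix.smul_mul,
          one_mul]
      have e2 : cliff (u z) * (V * cliff (u z) * G.A) = (u z ⬝ᵥ u z) • (V * G.A) := by
        rw [← Matrix.mul_assoc, ← mul_assoc, hDV, neg_mul, mul_assoc V, cliff_mul_self,
          Matrix.mul_smul, Matrix.mul_one, neg_smul, neg_neg, Matrix.smul_mul]
      have e3 : V * (V * cliff (u z) * G.A) = 0 := by
        rw [← Matrix.mul_assoc, ← mul_assoc, hVV, zero_mul, Matrix.zero_mul]
      rw [hq, map_add, map_add, map_smul, ← hW, ← hV, hp]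
      simp only [Matrix.add_mul, Matrix.mul_add, Matrix.smul_mul, Matrix.mul_smul, hWA, e1, e2, e3,
        hqu]
      module
    refine colSpan_le_iff.2 fun j => mem_spinorAnn_colSpan.2 (Fin.forall_fin_one.2 ?_)
    exact funext fun i => congrFun (congrFun hzero i) j
  · rintro q ⟨X, hX, hBX⟩
    obtain ⟨F', hF'⟩ := exists_hypFrame q
    set D := cliff (F'.A.col 0) with hD
    -- Transversality: the kernel of `D` has a basis `X` with `G.Bᵀ * X = 1`, so whatever is killed
    -- by both `D` and `G.Bᵀ` is zero.
    have hX' : ∀ T : Matrix (Fin 8) (Fin 8) ℂ, D * (T * V) = 0 → G.Bᵀ * (T * V) = 0 →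
        T * V = 0 := by
      intro T h1 h2
      obtain ⟨M, hM⟩ : ∃ M, T * V = X * M := exists_mul_of_colSpan_le (by
        rw [hX]
        change _ ≤ spinorAnn q.1
        rw [← hF']
        refine colSpan_le_iff.2 fun j => mem_spinorAnn_colSpan.2 (Fin.forall_fin_one.2 ?_)
        exact funext fun i => congrFun (congrFun h1 i) j)
      rw [hM, ← Matrix.mul_assoc, hBX, Matrix.one_mul] at h2
      rw [hM, h2, Matrix.mul_zero]
    -- Otherwise `D` and `V` anticommute. Transversality then kills `D * V`, next `V` itself,
    -- contradicting `W * V + V * W = -2`.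
    have hne : F.B.col 0 ⬝ᵥ F'.A.col 0 ≠ 0 := by
      intro h
      have hVD : V * D = -(D * V) := cliff_mul_of_orth h
      have hDD : D * D = 0 := by rw [hD, cliff_mul_self, F'.dot_AA, neg_zero, zero_smul]
      have h1 : D * V = 0 := hX' D (by rw [← mul_assoc, hDD, zero_mul]) (by
        rw [← neg_eq_iff_eq_neg.2 hVD, Matrix.mul_neg, ← Matrix.mul_assoc, hBV, Matrix.zero_mul,
          neg_zero])
      have h2 : V = 0 := by
        have := hX' 1 (by rw [one_mul, h1]) (by rw [one_mul, hBV])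
        rwa [one_mul] at this
      rw [h2, mul_zero, zero_mul, sub_zero] at hWV
      have h3 := congrFun (congrFun hWV 0) 0
      simp at h3
    refine ⟨(F.B.col 0 ⬝ᵥ F'.A.col 0)⁻¹ • F'.A, ?_, ?_⟩
    · rw [← hF']
      have h1 : ∀ (t : ℂ) (Z : Matrix (Fin 7) (Fin 1) ℂ), colSpan (t • Z) ≤ colSpan Z :=
        fun t Z => colSpan_le_iff.2 fun j => Submodule.smul_mem _ t (col_mem_colSpan Z j)
      refine le_antisymm (h1 _ _) ?_
      conv_lhs => rw [← inv_smul_smul₀ (inv_ne_zero hne) F'.A]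
      exact h1 _ _
    · ext i j
      rw [Subsingleton.elim i 0, Subsingleton.elim j 0, Matrix.mul_smul, Matrix.smul_apply]
      exact inv_mul_cancel₀ hne

end

end ExcHol

theorem proposition2p1 :
    (∃ Φ : Diffeomorph 𝓘(ℂ, ExcHol.GrModel 3 7) 𝓘(ℂ, ExcHol.GrModel 1 8)
        (ExcHol.IsoGr 3 7) (ExcHol.Quadric 6) ω,
      ExcHol.IsEquivariant (LieHom.id : ExcHol.so 7 →ₗ⁅ℂ⁆ ExcHol.so 7) ExcHol.spin Φ) ∧
    (∃ f : ExcHol.Quadric 5 → ExcHol.IsoGr 3 7,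
      Manifold.IsSmoothEmbedding 𝓘(ℂ, ExcHol.GrModel 1 7) 𝓘(ℂ, ExcHol.GrModel 3 7) ω f ∧
      ExcHol.IsEquivariant ExcHol.g2.incl ExcHol.g2.incl f) ∧
    (∃ f : ExcHol.Quadric 5 → ExcHol.IsoGr 4 8,
      Manifold.IsSmoothEmbedding 𝓘(ℂ, ExcHol.GrModel 1 7) 𝓘(ℂ, ExcHol.GrModel 4 8) ω f ∧
      ExcHol.IsEquivariant ExcHol.g2.incl (ExcHol.spin.comp ExcHol.g2.incl) f) :=
  ⟨⟨ExcHol.spinorDiffeomorph, ExcHol.isEquivariant_pureSpinor⟩,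
    ⟨ExcHol.quadricToGr, ExcHol.isSmoothEmbedding_quadricToGr, ExcHol.isEquivariant_quadricToGr⟩,
    ⟨ExcHol.quadricToGrSpinor, ExcHol.isSmoothEmbedding_quadricToGrSpinor,
      ExcHol.isEquivariant_quadricToGrSpinor⟩⟩
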